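/- Let $r>0$, $\sigma>0$, $2\kappa<r$. On a probability space, let $Z$ and $Y$ be standard Brownian motions, let $\theta_0\sim N(\mu_0,\sigma_0^2)$ be independent of $Z$, let $\theta$ be the continuous solution of $d\theta_t=\kappa\theta_t\,dt+\sigma\,dZ_t$ started at $\theta_0$, and let $Y$ be independent of $(\theta_t)_{t\ge 0}$. Put $\tilde{\mathcal F}_t=\sigma\big(Y_s\ (s\ge 0),\ \theta_s\ (s\le t)\big)$. A decision rule is an $(\tilde{\mathcal F}_t)$-adapted real process $A=(A_t)_{t\ge0}$ with right-continuous paths; $\mathcal F_t^A=\sigma(A_s:s\le t)$, and $u_R(A)=-\mathbf E\int_0^\infty re^{-rt}(A_t-\theta_t)^2\,dt\in[-\infty,0]$. The rule $A$ is obedient if for each $t\ge 0$, almost surely, $$\mathbf E\Big[\int_t^\infty re^{-r(s-t)}(A_s-\theta_s)^2\,ds\,\Big|\,\mathcal F_t^A\Big]\le\frac{\sigma^2+r\operatorname{Var}(\theta_t\mid\mathcal F_t^A)}{r-2\kappa}.$$ Let $RC$ be the set of right-continuous functions $[0,\infty)\to\mathbf R$, and let $\mathcal C_{t-}$ be the $\sigma$-algebra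 on $RC$ generated by the projections at times strictly before $t$. An information policy is a map $S$ from $[0,\infty)\times\Omega\times RC$ to a measurable space such that $S(t,\cdot,\cdot)$ is $\tilde{\mathcal F}_t\otimes\mathcal C_{t-}$-measurable for each $t$. For a decision rule $X$ and a function $T:RC\times RC\to[0,\infty]$ with $[T<t]\in\mathcal C_{t-}\otimes\mathcal C_{t-}$ for all $t$, the $(X,T)$-trigger policy is $S(t,\omega,a)=X_{t\wedge T(X(\omega),a)}(\omega)$. Consider any (labelled) family of information policies, called admissible, each associated with a collection of decision rules called compatible with it, such that: (C1) if $A$ is compatible with an admissible $S$, $t_0\ge 0$, $G\in\mathcal F^A_{t_0}$, and $A'$ is a decision rule such that $A'_t(\omega)=A_t(\omega)$ whenever $t<t_0$ or $\omega\notin G$ and such that $\mathbf 1_GA'_t$ is $\mathcal F^A_{t_0}$-measurable for all $t\ge t_0$, then $A'$ is compatible with $S$; (C2) every $(X,T)$-trigger policy is admissible (trigger policies being labelled by the pair $(X,T)$); (C3) a decision rule $A$ is compatible with the $(X,T)$-trigger policy if and only if $[A_t\in B]\cap[T(X,A)\wedge t<s]\in\mathcal F_s^X$ for every Borel set $B$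 and all times $s,t\ge0$. Call $A$ a best response to an admissible policy $S$ if $A$ is compatible with $S$ and $u_R(A)\ge u_R(A')$ for every decision rule $A'$ compatible with $S$. Then a decision rule $A$ is a best response to some admissible information policy if and only if $A$ is obedient. Moreover, every obedient $A$ is a best response to its direct, grim-trigger policy, that is, the $(A,T)$-trigger policy with $T(a,a')=\inf\{t\ge0:\int_0^t(a_s-a'_s)^2\,ds>0\}$ (where $\inf\emptyset=\infty$). -/

import Mathlib

open MeasureTheory ProbabilityTheory Set Filter Topology
open scoped NNReal ENNReal

universe u v w

namespace Persuasion

/-- `RC[0,∞)`: right-continuous functions from `[0,∞)` to `ℝ`. -/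
def RC : Type := {a : ℝ≥0 → ℝ // ∀ t, ContinuousWithinAt a (Ici t) t}

instance : CoeFun RC (fun _ => ℝ≥0 → ℝ) := ⟨Subtype.val⟩

/-- `𝒞_{t-}`: the σ-algebra on `RC[0,∞)` generated by the projections at times strictly
before `t`. -/
abbrev RC.before (t : ℝ≥0) : MeasurableSpace RC :=
  ⨆ (s : ℝ≥0) (_ : s < t), MeasurableSpace.comap (fun a : RC => a s) inferInstance

/-- The primitives of the model. The state solves `dθ = κ θ dt + σ dZ` (written in integrated
form) with `θ₀ ~ N(μ₀, σ₀²)` independent of the Brownian motion `Z`; the sender's randomization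
device `Y` is a Brownian motion independent of the whole state process. -/
structure Environment (Ω : Type u) [MeasurableSpace Ω] (P : Measure Ω) where
  /-- discount rate -/
  r : ℝ
  /-- persistence parameter -/
  κ : ℝ
  /-- volatility -/
  σ : ℝ
  /-- mean of the initial state -/
  μ₀ : ℝ
  /-- standard deviation of the initial state -/
  σ₀ : ℝ≥0
  r_pos : 0 < r
  σ_pos : 0 < σ
  two_κ_lt_r : 2 * κ < r
  /-- driving Brownian motion -/
  Z : ℝ≥0 → Ω → ℝ
  /-- randomization device -/
  Y : ℝ≥0 → Ω → ℝ
  /-- state process -/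
  θ : ℝ≥0 → Ω → ℝ
  measurable_Z : ∀ t, Measurable (Z t)
  measurable_Y : ∀ t, Measurable (Y t)
  measurable_θ : ∀ t, Measurable (θ t)
  brownian_Z : IsBrownianReal Z P
  brownian_Y : IsBrownianReal Y P
  law_θ_zero : HasLaw (θ 0) (gaussianReal μ₀ (σ₀ ^ 2)) P
  indep_θ_zero_Z : IndepFun (θ 0) (fun ω t => Z t ω) P
  continuous_θ : ∀ ω, Continuous (fun t => θ t ω)
  sde : ∀ᵐ ω ∂P, ∀ t : ℝ≥0,
    θ t ω = θ 0 ω + κ * (∫ s in (0 : ℝ)..(t : ℝ), θ s.toNNReal ω) + σ * Z t ω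
  indep_Y_θ : IndepFun (fun ω t => Y t ω) (fun ω t => θ t ω) P

variable {Ω : Type u} [MeasurableSpace Ω] {P : Measure Ω}

/-- `𝓕̃ᶿ_t = σ(σ(Y) ∪ 𝓕ᶿ_t)`: the exogenous information available to the sender at time `t`. -/
abbrev Environment.senderInfo (E : Environment Ω P) (t : ℝ≥0) : MeasurableSpace Ω :=
  (⨆ s : ℝ≥0, MeasurableSpace.comap (E.Y s) inferInstance) ⊔
    ⨆ (s : ℝ≥0) (_ : s ≤ t), MeasurableSpace.comap (E.θ s) inferInstance

theorem Environment.senderInfo_mono (E : Environment Ω P) : Monotone E.senderInfo :=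
  fun _ _ hst => sup_le_sup le_rfl (biSup_mono fun _ h => h.trans hst)

/-- A decision rule: a real process adapted to the sender's exogenous information, with
right-continuous sample paths. -/
structure DecisionRule (E : Environment Ω P) where
  path : Ω → RC
  adapted : ∀ t, Measurable[E.senderInfo t] (fun ω => path ω t)

namespace DecisionRule

variable {E : Environment Ω P}

/-- `𝓕ᴬ_t`, the σ-algebra generated by `A_s` for `s ≤ t`. -/
abbrev info (A : DecisionRule E) (t : ℝ≥0) : MeasurableSpace Ω :=
  ⨆ (s : ℝ≥0) (_ : s ≤ t), MeasurableSpace.comap (fun ω => A.path ω s) inferInstance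

/-- The receiver's realized continuation loss `∫_t^∞ r e^{-r(s-t)} (A_s - θ_s)² ds`. -/
noncomputable def contLoss (A : DecisionRule E) (t : ℝ≥0) (ω : Ω) : ℝ≥0∞ :=
  ∫⁻ s in Ioi (t : ℝ), ENNReal.ofReal
    (E.r * Real.exp (-E.r * (s - t)) * (A.path ω s.toNNReal - E.θ s.toNNReal ω) ^ 2)

/-- The receiver's utility `u_R(A) = E[∫_0^∞ r e^{-rt} (-(A_t - θ_t)²) dt]`, a number in
`[-∞, 0]`. -/
noncomputable def receiverUtility (A : DecisionRule E) : EReal :=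
  -((∫⁻ ω, A.contLoss 0 ω ∂P : ℝ≥0∞) : EReal)

/-- Obedience: at every time `t`, almost surely, the expected continuation loss conditional on
`𝓕ᴬ_t` is at most `(σ² + r Var(θ_t | 𝓕ᴬ_t)) / (r - 2κ)`. The loss is nonnegative and possibly not
integrable, so its conditional expectation is the `[0,∞]`-valued one. -/
def Obedient (A : DecisionRule E) : Prop :=
  ∀ t : ℝ≥0, ∀ᵐ ω ∂P,
    condLExp (A.info t) P (A.contLoss t) ω ≤
      ENNReal.ofReal ((E.σ ^ 2 + E.r * condVar (A.info t) (E.θ t) P ω) / (E.r - 2 * E.κ))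

/-- `A'` modifies `A` from time `t₀` on, on the event `G`, using only information available at
time `t₀`. -/
def IsModification (A A' : DecisionRule E) (t₀ : ℝ≥0) (G : Set Ω) : Prop :=
  MeasurableSet[A.info t₀] G ∧
    (∀ t ω, t < t₀ ∨ ω ∉ G → A'.path ω t = A.path ω t) ∧
    ∀ t, t₀ ≤ t → Measurable[A.info t₀] (G.indicator fun ω => A'.path ω t)

end DecisionRule

/-- An information policy: a measurable space of signals and a signal process that depends on the
sender's exogenous information and on the actions taken strictly before the current time. -/
structure InfoPolicy (E : Environment Ω P) where
  Signal : Type v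
  measSignal : MeasurableSpace Signal
  signal : ℝ≥0 → Ω × RC → Signal
  adapted : ∀ t, @Measurable _ _ ((E.senderInfo t).prod (RC.before t)) measSignal (signal t)

/-- A stopping functional `T : RC × RC → [0,∞]` such that `[T < t] ∈ 𝒞_{t-} ⊗ 𝒞_{t-}` for every
time `t`. -/
structure TriggerTime where
  time : RC → RC → ℝ≥0∞
  measurableSet_lt : ∀ t : ℝ≥0,
    MeasurableSet[(RC.before t).prod (RC.before t)] {p : RC × RC | time p.1 p.2 < t}

/-- `t ∧ T(x, a)` as a finite time. -/
noncomputable def TriggerTime.capped (T : TriggerTime) (t : ℝ≥0) (x a : RC) : ℝ≥0 :=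
  (min (t : ℝ≥0∞) (T.time x a)).toNNReal

theorem TriggerTime.coe_capped (T : TriggerTime) (t : ℝ≥0) (x a : RC) :
    (T.capped t x a : ℝ≥0∞) = min (t : ℝ≥0∞) (T.time x a) :=
  ENNReal.coe_toNNReal (ne_top_of_le_ne_top ENNReal.coe_ne_top (min_le_left _ _))

theorem TriggerTime.capped_le (T : TriggerTime) (t : ℝ≥0) (x a : RC) : T.capped t x a ≤ t := by
  rw [← ENNReal.coe_le_coe, T.coe_capped]
  exact min_le_left _ _

theorem measurable_eval_nat {α : Type*} {m : MeasurableSpace α} {K : α → ℕ} (hK : Measurable K)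
    {g : ℕ → α → ℝ} (hg : ∀ k, Measurable (g k)) : Measurable (fun p => g (K p) p) := by
  have h1 : Measurable (fun q : ℕ × α => g q.1 q.2) := measurable_from_prod_countable_right hg
  exact h1.comp (hK.prodMk measurable_id)

/-- A right-continuous process evaluated at a bounded random time. -/
theorem measurable_eval_random_time {α : Type*} {m : MeasurableSpace α} (t : ℝ≥0)
    (x : ℝ≥0 → α → ℝ) (hx : ∀ s, s ≤ t → Measurable (x s))
    (hc : ∀ p s, ContinuousWithinAt (fun s => x s p) (Ici s) s)
    (τ : α → ℝ≥0) (hτ : Measurable τ) (hτt : ∀ p, τ p ≤ t) :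
    Measurable (fun p => x (τ p) p) := by
  let ap : ℕ → ℕ → ℝ≥0 := fun n k => min t (((k : ℝ≥0) + 1) / ((n : ℝ≥0) + 1))
  let K : ℕ → α → ℕ := fun n p => ⌊((n : ℝ≥0) + 1) * τ p⌋₊
  have hK : ∀ n, Measurable (K n) := fun n =>
    Nat.measurable_floor.comp (measurable_const.mul hτ)
  refine measurable_of_tendsto_metrizable (f := fun n p => x (ap n (K n p)) p) ?_ ?_
  · exact fun n => measurable_eval_nat (hK n) (g := fun k p => x (ap n k) p)
      fun k => hx (ap n k) (min_le_left _ _)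
  · rw [tendsto_pi_nhds]
    intro p
    have hge : ∀ n, τ p ≤ ap n (K n p) := by
      intro n
      refine le_min (hτt p) ?_
      rw [le_div_iff₀ (by positivity), mul_comm]
      exact (Nat.lt_floor_add_one _).le
    have hle : ∀ n, ap n (K n p) ≤ τ p + 1 / ((n : ℝ≥0) + 1) := by
      intro n
      refine (min_le_right _ _).trans ?_
      rw [add_div]
      gcongr
      rw [div_le_iff₀ (by positivity), mul_comm]
      exact Nat.floor_le (zero_le)
    have hlim : Tendsto (fun n => ap n (K n p)) atTop (𝓝 (τ p)) := by
      refine tendsto_of_tendsto_of_tendsto_of_le_of_le tendsto_const_nhds ?_ hge hle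
      have h0 : Tendsto (fun n : ℕ => 1 / ((n : ℝ≥0) + 1)) atTop (𝓝 0) :=
        tendsto_one_div_add_atTop_nhds_zero_nat
      simpa using (tendsto_const_nhds (x := τ p)).add h0
    exact (hc p (τ p)).tendsto.comp
      (tendsto_nhdsWithin_iff.2 ⟨hlim, Eventually.of_forall hge⟩)

variable {E : Environment Ω P}

theorem measurable_comp_fst {α β γ : Type*} (m₁ : MeasurableSpace α) (m₂ : MeasurableSpace β)
    (m₃ : MeasurableSpace γ) {f : α → γ} (hf : Measurable f) :
    @Measurable _ _ (m₁.prod m₂) m₃ (fun p : α × β => f p.1) :=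
  hf.comp measurable_fst

theorem measurable_comp_snd {α β γ : Type*} (m₁ : MeasurableSpace α) (m₂ : MeasurableSpace β)
    (m₃ : MeasurableSpace γ) {f : β → γ} (hf : Measurable f) :
    @Measurable _ _ (m₁.prod m₂) m₃ (fun p : α × β => f p.2) :=
  hf.comp measurable_snd

theorem measurable_pair {α β γ : Type*} (m₁ : MeasurableSpace α) (m₂ : MeasurableSpace β)
    (m₃ : MeasurableSpace γ) {f : α → β} {g : α → γ} (hf : Measurable f) (hg : Measurable g) :
    @Measurable _ _ m₁ (m₂.prod m₃) (fun p => (f p, g p)) :=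
  hf.prodMk hg

theorem measurable_of_lt_sets {α : Type*} (m : MeasurableSpace α) {f : α → ℝ≥0}
    (h : ∀ s, MeasurableSet {p | f p < s}) : Measurable f :=
  measurable_of_Iio h

theorem measurableSet_ne_of_measurable {α : Type*} (m : MeasurableSpace α) {f g : α → ℝ}
    (hf : Measurable f) (hg : Measurable g) : MeasurableSet {p | f p ≠ g p} :=
  (measurableSet_eq_fun hf hg).compl

theorem DecisionRule.measurable_pair_before (X : DecisionRule E) {s t : ℝ≥0} (hst : s ≤ t) :
    @Measurable _ _ ((E.senderInfo t).prod (RC.before t)) ((RC.before s).prod (RC.before s))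
      (fun p : Ω × RC => (X.path p.1, p.2)) := by
  refine measurable_pair _ _ _ (f := fun p : Ω × RC => X.path p.1) (g := fun p => p.2)
    (measurable_comp_fst _ _ _ ?_) (measurable_comp_snd _ _ _ (f := fun a : RC => a) ?_)
  · rw [measurable_iff_comap_le, RC.before]
    simp only [MeasurableSpace.comap_iSup, MeasurableSpace.comap_comp]
    refine iSup₂_le fun q hq => ?_
    rw [← measurable_iff_comap_le]
    exact (X.adapted q).mono (E.senderInfo_mono (hq.le.trans hst)) le_rfl
  · have h : RC.before s ≤ RC.before t := biSup_mono fun _ h => h.trans_le hst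
    exact measurable_id'' h

/-- The `(X,T)`-trigger information policy `S(t, ω, a) = X_{t ∧ T(X(ω), a)}(ω)`. Signals are real
numbers (lifted to the universe of signal spaces). -/
noncomputable def triggerPolicy (X : DecisionRule E) (T : TriggerTime) :
    InfoPolicy.{u, v} E where
  Signal := ULift.{v} ℝ
  measSignal := inferInstance
  signal t p := ULift.up (X.path p.1 (T.capped t (X.path p.1) p.2))
  adapted t := by
    refine measurable_up.comp ?_
    refine measurable_eval_random_time (m := (E.senderInfo t).prod (RC.before t)) t
      (fun s p => X.path p.1 s) (fun s hs => ?_) (fun p s => (X.path p.1).2 s)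
      (fun p => T.capped t (X.path p.1) p.2) ?_ (fun p => T.capped_le _ _ _)
    · exact measurable_comp_fst _ _ _ ((X.adapted s).mono (E.senderInfo_mono hs) le_rfl)
    · refine measurable_of_lt_sets _ fun s => ?_
      rcases le_or_gt s t with hs | hs
      · convert X.measurable_pair_before hs (T.measurableSet_lt s) using 1
        ext p
        simp only [mem_preimage, mem_ofPred_eq]
        rw [← ENNReal.coe_lt_coe, T.coe_capped, min_lt_iff, ENNReal.coe_lt_coe]
        simp [hs.not_gt]
      · convert @MeasurableSet.univ _ ((E.senderInfo t).prod (RC.before t)) using 1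
        ext p
        simpa using (T.capped_le t (X.path p.1) p.2).trans_lt hs

theorem RC.eventually_lt_sq_sub (a b : RC) {q : ℝ≥0} (h : a q ≠ b q) :
    ∃ c : ℝ, 0 < c ∧ ∀ᶠ s in 𝓝[≥] q, c < (a s - b s) ^ 2 := by
  have hpos : 0 < (a q - b q) ^ 2 := by
    have := sub_ne_zero.2 h
    positivity
  refine ⟨(a q - b q) ^ 2 / 2, by positivity, ?_⟩
  have hc : ContinuousWithinAt (fun s => (a s - b s) ^ 2) (Ici q) q :=
    ((a.2 q).sub (b.2 q)).pow 2
  exact hc.eventually (lt_mem_nhds (by linarith))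

/-- The first time two paths disagree:
`inf {t ≥ 0 : ∫_0^t (a_s - b_s)² ds > 0}`, with `inf ∅ = ∞`. -/
noncomputable def disagreementTime (a b : RC) : ℝ≥0∞ :=
  ⨅ (t : ℝ≥0) (_ : 0 < ∫⁻ s in Ioo (0 : ℝ) t,
    ENNReal.ofReal ((a s.toNNReal - b s.toNNReal) ^ 2)), (t : ℝ≥0∞)

theorem disagreementTime_lt_iff (a b : RC) (t : ℝ≥0) :
    disagreementTime a b < t ↔ ∃ q : ℚ, Real.toNNReal (q : ℝ) < t ∧
      a (Real.toNNReal (q : ℝ)) ≠ b (Real.toNNReal (q : ℝ)) := by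
  simp only [disagreementTime, iInf_lt_iff, ENNReal.coe_lt_coe, exists_prop]
  constructor
  · rintro ⟨s, hs, hst⟩
    obtain ⟨x, hx, hne⟩ : ∃ x ∈ Ioo (0 : ℝ) s, a x.toNNReal ≠ b x.toNNReal := by
      by_contra! hcon
      refine hs.ne' ?_
      rw [setLIntegral_congr_fun (g := fun _ => 0) measurableSet_Ioo
        (fun x hx => by simp [hcon x hx])]
      simp
    obtain ⟨c, hc, hev⟩ := RC.eventually_lt_sq_sub a b hne
    have hxs : x.toNNReal < s := by
      rw [Real.toNNReal_lt_iff_lt_coe hx.1.le]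
      exact hx.2
    obtain ⟨y, hy, hyI⟩ := (mem_nhdsGE_iff_exists_Ico_subset' hxs).1 hev
    have hlt : (x.toNNReal : ℝ) < min (y : ℝ) s := lt_min (by exact_mod_cast hy)
      (by exact_mod_cast hxs)
    obtain ⟨q, hq1, hq2⟩ := exists_rat_btwn hlt
    have hq0 : (0 : ℝ) ≤ q := (NNReal.coe_nonneg _).trans hq1.le
    refine ⟨q, ?_, ?_⟩
    · refine lt_of_lt_of_le ?_ hst.le
      rw [Real.toNNReal_lt_iff_lt_coe hq0]
      exact hq2.trans_le (min_le_right _ _)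
    · have := hyI (show Real.toNNReal q ∈ Ico x.toNNReal y from
        ⟨(NNReal.le_toNNReal_of_coe_le hq1.le),
          (Real.toNNReal_lt_iff_lt_coe hq0).2 (hq2.trans_le (min_le_left _ _))⟩)
      intro he
      change c < _ at this
      rw [he, sub_self] at this
      norm_num at this
      linarith
  · rintro ⟨q, hqt, hne⟩
    obtain ⟨c, hc, hev⟩ := RC.eventually_lt_sq_sub a b hne
    obtain ⟨y, hy, hyI⟩ := (mem_nhdsGE_iff_exists_Ico_subset' hqt).1 hev
    obtain ⟨s, hqs, hs⟩ := exists_between (lt_min hy hqt)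
    refine ⟨s, ?_, hs.trans_le (min_le_right _ _)⟩
    set p : ℝ≥0 := Real.toNNReal q
    have hps : (p : ℝ) < s := by exact_mod_cast hqs
    calc 0 < ENNReal.ofReal c * ENNReal.ofReal (s - p) := by
          refine ENNReal.mul_pos ?_ ?_
          · simpa using hc
          · simpa using hqs
      _ = ∫⁻ _ in Ioo (p : ℝ) s, ENNReal.ofReal c := by simp
      _ ≤ ∫⁻ x in Ioo (p : ℝ) s, ENNReal.ofReal ((a x.toNNReal - b x.toNNReal) ^ 2) := by
          refine setLIntegral_mono' measurableSet_Ioo fun x hx => ?_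
          refine ENNReal.ofReal_le_ofReal (le_of_lt ?_)
          have hx0 : (0 : ℝ) ≤ x := p.coe_nonneg.trans hx.1.le
          refine hyI ⟨NNReal.le_toNNReal_of_coe_le hx.1.le, ?_⟩
          refine ((Real.toNNReal_lt_iff_lt_coe hx0).2 hx.2).trans ?_
          exact hs.trans_le (min_le_left _ _)
      _ ≤ _ := lintegral_mono_set (Ioo_subset_Ioo_left p.coe_nonneg)

/-- The grim trigger: information is cut off once the receiver's path has departed from the
recommended path. -/
noncomputable def grimTrigger : TriggerTime where
  time := disagreementTime
  measurableSet_lt t := by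
    simp only [disagreementTime_lt_iff]
    have : {p : RC × RC | ∃ q : ℚ, Real.toNNReal (q : ℝ) < t ∧
          p.1 (Real.toNNReal (q : ℝ)) ≠ p.2 (Real.toNNReal (q : ℝ))} =
        ⋃ q : ℚ, ⋃ _ : Real.toNNReal (q : ℝ) < t,
          {p : RC × RC | p.1 (Real.toNNReal (q : ℝ)) ≠ p.2 (Real.toNNReal (q : ℝ))} := by
      ext p
      simp
    rw [this]
    refine @MeasurableSet.iUnion _ _ (_) _ _ fun q => @MeasurableSet.iUnion _ _ (_) _ _ fun hq => ?_
    have hev : Measurable[RC.before t] (fun a : RC => a (Real.toNNReal (q : ℝ))) :=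
      Measurable.mono (comap_measurable _)
        (le_iSup₂ (f := fun (s : ℝ≥0) (_ : s < t) =>
          MeasurableSpace.comap (fun a : RC => a s) inferInstance)
          (Real.toNNReal (q : ℝ)) hq) le_rfl
    exact measurableSet_ne_of_measurable _ (measurable_comp_fst _ _ _ hev)
      (measurable_comp_snd _ _ _ hev)

/-- A collection of admissible information policies, with the decision rules compatible with each
of them. The collection is a labelled family: distinct trigger specifications `(X,T)` may produce
the same signal map and yet have different compatible decision rules. -/
structure PolicyClass (E : Environment Ω P) where
  Label : Type w
  policy : Label → InfoPolicy.{u, v} E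
  Compatible : DecisionRule E → Label → Prop

namespace PolicyClass

/-- `A` is a best response to the admissible policy `S`: it is compatible with `S` and gives the
receiver at least as much utility as every decision rule compatible with `S`. -/
def IsBestResponse (𝒜 : PolicyClass.{u, v, w} E) (A : DecisionRule E) (S : 𝒜.Label) : Prop :=
  𝒜.Compatible A S ∧
    ∀ A' : DecisionRule E, 𝒜.Compatible A' S → A'.receiverUtility ≤ A.receiverUtility

/-- C1: compatibility is preserved when, from a fixed time `t₀` on and on an event
`G ∈ 𝓕ᴬ_{t₀}`, actions are replaced by `𝓕ᴬ_{t₀}`-measurable ones. -/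
def ModificationAxiom (𝒜 : PolicyClass.{u, v, w} E) : Prop :=
  ∀ (S : 𝒜.Label) (A A' : DecisionRule E) (t₀ : ℝ≥0) (G : Set Ω),
    𝒜.Compatible A S → A.IsModification A' t₀ G → 𝒜.Compatible A' S

/-- C2: `trig X T` is an admissible policy that is the `(X,T)`-trigger policy, for all `X`, `T`. -/
def TriggerAdmissible (𝒜 : PolicyClass.{u, v, w} E)
    (trig : DecisionRule E → TriggerTime → 𝒜.Label) : Prop :=
  ∀ X T, 𝒜.policy (trig X T) = triggerPolicy X T

/-- C3: `A` is compatible with the `(X,T)`-trigger policy if and only if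
`[A_t ∈ B] ∩ [T(X, A) ∧ t < s] ∈ 𝓕ˣ_s` for all Borel sets `B` and all times `s`, `t`. -/
def TriggerCompatibility (𝒜 : PolicyClass.{u, v, w} E)
    (trig : DecisionRule E → TriggerTime → 𝒜.Label) : Prop :=
  ∀ (X : DecisionRule E) (T : TriggerTime) (A : DecisionRule E),
    𝒜.Compatible A (trig X T) ↔
      ∀ (B : Set ℝ) (s t : ℝ≥0), MeasurableSet B →
        MeasurableSet[X.info s]
          ({ω | A.path ω t ∈ B} ∩ {ω | min (T.time (X.path ω) (A.path ω)) (t : ℝ≥0∞) < s})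

end PolicyClass

end Persuasion

open Persuasion

/-!
A best response exists to some policy exactly when the rule is obedient, because the bound in the
definition of obedience is the value of a concrete deviation, "stop learning now".

**The state equation.** The noise `W = (θ - θ₀ - κ ∫ θ) / σ` is a continuous version of `Z`, and
variation of constants turns the state equation into the pathwise identity
`θ_{t+u} = e^{κu} θ_t + ξ`, where the shock `ξ` is a linear functional of the increments of `W` after
`t` (`Environment.shock_eq`). Hence `ξ` is independent of the sender's information at `t`
(`Environment.indep_shock_senderInfo`), has mean zero and has variance `σ² ∫_0^u e^{2κx} dx`
(`Environment.integral_shock_sq`).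

**The value of stopping to learn.** Let `𝒢` be contained in the sender's information at `t`. Among
`𝒢`-measurable guesses of `θ_{t+u}`, the forecast `e^{κu} E[θ_t | 𝒢]` is optimal, with conditional
mean-square error `e^{2κu} Var(θ_t | 𝒢)` plus the variance of the shock. The discounted integral of
this error over `u` is `(σ² + r Var(θ_t | 𝒢)) / (r - 2κ)`. So on every event of `𝒢` an agent who
learns nothing after `t` loses at least this much (`DecisionRule.setLIntegral_lossBound_le`), with
equality for the forecast (`DecisionRule.setLIntegral_contLoss_eq_lossBound`).

**Best responses are obedient.** The modification axiom makes every forecasting deviation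
`DecisionRule.forecastFrom` compatible. Deviating at time zero shows that a best response has finite
loss; if obedience failed at `t`, deviating at `t` on the event of failure would then be strictly
profitable (`DecisionRule.obedient_of_forecastFrom_le`).

**Obedient rules are best responses to their grim triggers.** A rule compatible with the grim trigger
agrees with the obedient rule `A` before the first disagreement `T`, an optional time of `A`, and
learns nothing afterwards. On the event that `T` falls in a given cell of a grid, both rules
can be compared from the right endpoint of the cell on: the deviator loses at least the bound and `A`
at most the bound. Refining the grid and applying Fatou's lemma compares the losses after `T` itself
(`DecisionRule.Obedient.lintegral_contLoss_le`).
-/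

namespace Persuasion

/-! ### Variation of constants and the variance kernel -/

theorem hasDerivAt_primitive {y : ℝ → ℝ} (hy : Continuous y) (w : ℝ) :
    HasDerivAt (fun w => ∫ v in (0 : ℝ)..w, y v) (y w) w :=
  (hy.integral_hasStrictDerivAt 0 w).hasDerivAt

theorem hasDerivAt_exp_kernel (κ u w : ℝ) :
    HasDerivAt (fun w => Real.exp (κ * (u - w))) (-(κ * Real.exp (κ * (u - w)))) w :=
  (((hasDerivAt_id' w).const_sub u).const_mul κ).exp.congr_deriv (by ring)

/-- **Variation of constants**: the solution of `y = y₀ + κ ∫ y + x` is an explicit linear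
functional of the forcing path `x`. No regularity of `x` is assumed beyond that inherited from `y`. -/
theorem variation_of_constants {κ y₀ u : ℝ} {x y : ℝ → ℝ} (hy : Continuous y)
    (hu : 0 ≤ u) (h : ∀ w ∈ Icc 0 u, y w = y₀ + κ * (∫ v in (0 : ℝ)..w, y v) + x w) :
    y u = Real.exp (κ * u) * y₀ +
      (x u + ∫ w in (0 : ℝ)..u, κ * Real.exp (κ * (u - w)) * x w) := by
  have hI : ∀ w, HasDerivAt (fun w => ∫ v in (0 : ℝ)..w, y v) (y w) w :=
    hasDerivAt_primitive hy
  have hIc : Continuous fun w => ∫ v in (0 : ℝ)..w, y v :=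
    continuous_iff_continuousAt.2 fun w => (hI w).continuousAt
  have hg : ∀ w, HasDerivAt (fun w => Real.exp (κ * (u - w))) (-(κ * Real.exp (κ * (u - w)))) w :=
    hasDerivAt_exp_kernel κ u
  have h1 : ∫ w in (0 : ℝ)..u, κ * Real.exp (κ * (u - w)) * (y w - κ * ∫ v in (0 : ℝ)..w, y v) =
      κ * ∫ v in (0 : ℝ)..u, y v := by
    have := intervalIntegral.integral_eq_sub_of_hasDerivAt
      (f := fun w => κ * (Real.exp (κ * (u - w)) * ∫ v in (0 : ℝ)..w, y v))
      (f' := fun w => κ * Real.exp (κ * (u - w)) * (y w - κ * ∫ v in (0 : ℝ)..w, y v))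
      (a := 0) (b := u) (fun w _ =>
        (((hg w).fun_mul (hI w)).const_mul κ).congr_deriv (by ring))
          ((by fun_prop : Continuous _).intervalIntegrable _ _)
    rw [this]
    simp
  have h2 : ∫ w in (0 : ℝ)..u, κ * Real.exp (κ * (u - w)) * y₀ = (Real.exp (κ * u) - 1) * y₀ := by
    have := intervalIntegral.integral_eq_sub_of_hasDerivAt
      (f := fun w => -(Real.exp (κ * (u - w)) * y₀))
      (f' := fun w => κ * Real.exp (κ * (u - w)) * y₀)
      (a := 0) (b := u) (fun w _ =>
        ((hg w).mul_const y₀).fun_neg.congr_deriv (by ring))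
          ((by fun_prop : Continuous _).intervalIntegrable _ _)
    rw [this]
    simp; ring
  have h3 : ∫ w in (0 : ℝ)..u, κ * Real.exp (κ * (u - w)) * x w =
      κ * (∫ v in (0 : ℝ)..u, y v) - (Real.exp (κ * u) - 1) * y₀ := by
    rw [← h1, ← h2, ← intervalIntegral.integral_sub
      ((by fun_prop : Continuous _).intervalIntegrable _ _)
      ((by fun_prop : Continuous _).intervalIntegrable _ _)]
    refine intervalIntegral.integral_congr fun w hw => ?_
    rw [uIcc_of_le hu] at hw
    rw [h w hw]
    ring
  rw [h3, h u ⟨hu, le_rfl⟩]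
  ring

/-- The covariance of the time-`w'` value of a Brownian motion with the Wiener integral
`∫_0^u e^{κ(u-x)} dX_x`, the latter written after integration by parts. -/
theorem kernel_covariance (κ : ℝ) {u w' : ℝ} (h0 : 0 ≤ w') (hu : w' ≤ u) :
    w' + ∫ w in (0 : ℝ)..u, κ * Real.exp (κ * (u - w)) * min w w' =
      ∫ x in (0 : ℝ)..w', Real.exp (κ * (u - x)) := by
  have hc : Continuous fun w => Real.exp (κ * (u - w)) := by fun_prop
  have hI : ∀ w, HasDerivAt (fun w => ∫ v in (0 : ℝ)..w, Real.exp (κ * (u - v)))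
      (Real.exp (κ * (u - w))) w :=
    hasDerivAt_primitive hc
  have h1 : ∫ w in (0 : ℝ)..w', κ * Real.exp (κ * (u - w)) * min w w' =
      -(Real.exp (κ * (u - w')) * w') + ∫ x in (0 : ℝ)..w', Real.exp (κ * (u - x)) := by
    rw [intervalIntegral.integral_congr (g := fun w => κ * Real.exp (κ * (u - w)) * w)
      (fun w hw => by rw [uIcc_of_le h0] at hw; simp [min_eq_left hw.2])]
    rw [intervalIntegral.integral_eq_sub_of_hasDerivAt
      (f := fun w => -(Real.exp (κ * (u - w)) * w) + ∫ x in (0 : ℝ)..w, Real.exp (κ * (u - x)))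
      (fun w _ =>
        ((((hasDerivAt_exp_kernel κ u w).fun_mul (hasDerivAt_id' w)).fun_neg).fun_add
          (hI w)).congr_deriv (by ring))
            ((by fun_prop : Continuous _).intervalIntegrable _ _)]
    simp
  have h2 : ∫ w in w'..u, κ * Real.exp (κ * (u - w)) * min w w' =
      (Real.exp (κ * (u - w')) - 1) * w' := by
    rw [intervalIntegral.integral_congr (g := fun w => κ * Real.exp (κ * (u - w)) * w')
      (fun w hw => by rw [uIcc_of_le hu] at hw; simp [min_eq_right hw.1])]
    rw [intervalIntegral.integral_eq_sub_of_hasDerivAt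
      (f := fun w => -(Real.exp (κ * (u - w)) * w'))
      (fun w _ =>
        ((hasDerivAt_exp_kernel κ u w).mul_const w').fun_neg.congr_deriv (by ring))
          ((by fun_prop : Continuous _).intervalIntegrable _ _)]
    simp; ring
  rw [← intervalIntegral.integral_add_adjacent_intervals (b := w')
    ((by fun_prop : Continuous _).intervalIntegrable _ _)
    ((by fun_prop : Continuous _).intervalIntegrable _ _), h1, h2]
  ring

/-- The Itô isometry for the kernel `e^{κ(u-x)}`, in the form obtained after two integrations by
parts. -/
theorem kernel_variance (κ u : ℝ) :
    (∫ x in (0 : ℝ)..u, Real.exp (κ * (u - x))) +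
      ∫ w in (0 : ℝ)..u, κ * Real.exp (κ * (u - w)) * ∫ x in (0 : ℝ)..w, Real.exp (κ * (u - x)) =
      ∫ x in (0 : ℝ)..u, Real.exp (2 * κ * x) := by
  have hc : Continuous fun w => Real.exp (κ * (u - w)) := by fun_prop
  have hI : ∀ w, HasDerivAt (fun w => ∫ v in (0 : ℝ)..w, Real.exp (κ * (u - v)))
      (Real.exp (κ * (u - w))) w :=
    hasDerivAt_primitive hc
  have hIc : Continuous fun w => ∫ v in (0 : ℝ)..w, Real.exp (κ * (u - v)) :=
    continuous_iff_continuousAt.2 fun w => (hI w).continuousAt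
  have hc2 : Continuous fun w => Real.exp (2 * κ * (u - w)) := by fun_prop
  have hJ : ∀ w, HasDerivAt (fun w => ∫ v in (0 : ℝ)..w, Real.exp (2 * κ * (u - v)))
      (Real.exp (2 * κ * (u - w))) w :=
    hasDerivAt_primitive hc2
  rw [intervalIntegral.integral_eq_sub_of_hasDerivAt
      (f := fun w => -(Real.exp (κ * (u - w)) * ∫ x in (0 : ℝ)..w, Real.exp (κ * (u - x))) +
        ∫ v in (0 : ℝ)..w, Real.exp (2 * κ * (u - v)))
      (f' := fun w => κ * Real.exp (κ * (u - w)) * ∫ x in (0 : ℝ)..w, Real.exp (κ * (u - x)))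
      (fun w _ =>
        ((((hasDerivAt_exp_kernel κ u w).fun_mul (hI w)).fun_neg).fun_add (hJ w)).congr_deriv (by
          rw [show 2 * κ * (u - w) = κ * (u - w) + κ * (u - w) by ring, Real.exp_add]
          ring))
            ((by fun_prop : Continuous _).intervalIntegrable _ _)]
  have := intervalIntegral.integral_comp_sub_left (a := 0) (b := u)
    (fun x => Real.exp (2 * κ * x)) u
  simp only [sub_self, sub_zero] at this
  simp only [this, intervalIntegral.integral_same, mul_zero, neg_zero, add_zero, sub_zero,
    sub_self, Real.exp_zero, one_mul]
  ring

/-! ### Processes with continuous paths -/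

/-- A path integral over `[0, u]` only involves the process up to time `u`. -/
theorem measurable_intervalIntegral_of_continuous {Ω : Type*} {m : MeasurableSpace Ω}
    {x : ℝ → Ω → ℝ} {f : ℝ → ℝ} (hf : Continuous f) {u : ℝ} (hu : 0 ≤ u)
    (hx : ∀ w ∈ Icc 0 u, Measurable (x w)) (hc : ∀ ω, Continuous fun w => x w ω) :
    Measurable fun ω => ∫ w in (0 : ℝ)..u, f w * x w ω := by
  have hcl : ∀ w, max 0 (min w u) ∈ Icc 0 u := fun w =>
    ⟨le_max_left _ _, max_le hu (min_le_right _ _)⟩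
  have hm : StronglyMeasurable fun p : Ω × ℝ => f p.2 * x (max 0 (min p.2 u)) p.1 := by
    have h1 : Measurable fun p : ℝ × Ω => x (max 0 (min p.1 u)) p.2 :=
      measurable_uncurry_of_continuous_of_measurable
        (u := fun w ω => x (max 0 (min w u)) ω)
        (fun ω => (hc ω).comp (by fun_prop)) fun w => hx _ (hcl w)
    exact ((hf.measurable.comp measurable_snd).mul (h1.comp measurable_swap)).stronglyMeasurable
  have h2 := hm.integral_prod_right' (ν := volume.restrict (Ioc 0 u))
  convert h2.measurable using 2 with ω
  rw [intervalIntegral.integral_of_le hu]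
  refine setIntegral_congr_fun measurableSet_Ioc fun w hw => ?_
  simp [min_eq_left hw.2, max_eq_right hw.1.le]

/-- Cauchy–Schwarz against the constant function. -/
theorem sq_intervalIntegral_le {h : ℝ → ℝ} (hc : Continuous h) {u : ℝ} (hu : 0 < u) :
    (∫ w in (0 : ℝ)..u, h w) ^ 2 ≤ u * ∫ w in (0 : ℝ)..u, h w ^ 2 := by
  set I := ∫ w in (0 : ℝ)..u, h w with hI
  have h0 : 0 ≤ ∫ w in (0 : ℝ)..u, (h w - I / u) ^ 2 :=
    intervalIntegral.integral_nonneg hu.le fun _ _ => sq_nonneg _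
  have h1 : ∫ w in (0 : ℝ)..u, (h w - I / u) ^ 2 =
      (∫ w in (0 : ℝ)..u, h w ^ 2) - 2 * (I / u) * I + u * (I / u) ^ 2 := by
    have : ∀ w, (h w - I / u) ^ 2 = h w ^ 2 - 2 * (I / u) * h w + (I / u) ^ 2 := fun w => by ring
    simp_rw [this]
    rw [intervalIntegral.integral_add, intervalIntegral.integral_sub,
      intervalIntegral.integral_const_mul, intervalIntegral.integral_const, ← hI]
    · simp
    all_goals exact (by fun_prop : Continuous _).intervalIntegrable _ _
  rw [h1] at h0
  have h2 : u * (I / u) ^ 2 - 2 * (I / u) * I = - (I ^ 2 / u) := by field_simp; ring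
  have h3 : I ^ 2 / u ≤ ∫ w in (0 : ℝ)..u, h w ^ 2 := by linarith
  rw [div_le_iff₀ hu] at h3
  linarith

section Moments

variable {Ω : Type*} [MeasurableSpace Ω] {P : Measure Ω} [IsProbabilityMeasure P]
  {x : ℝ → Ω → ℝ} {f : ℝ → ℝ} {u : ℝ}

theorem memLp_uncurry_of_second_moment (hf : Continuous f) (hx : ∀ w, Measurable (x w))
    (hc : ∀ ω, Continuous fun w => x w ω) (hL : ∀ w, MemLp (x w) 2 P)
    (hsq : ∀ w, 0 ≤ w → ∫ ω, x w ω ^ 2 ∂P = w) :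
    MemLp (fun p : ℝ × Ω => f p.1 * x p.1 p.2) 2 ((volume.restrict (Ioc 0 u)).prod P) := by
  have hm : Measurable fun p : ℝ × Ω => f p.1 * x p.1 p.2 :=
    (hf.measurable.comp measurable_fst).mul
      (measurable_uncurry_of_continuous_of_measurable (u := x) hc hx)
  rw [memLp_two_iff_integrable_sq hm.aestronglyMeasurable]
  rw [integrable_prod_iff (hm.pow_const 2).aestronglyMeasurable]
  constructor
  · refine Eventually.of_forall fun w => ?_
    simp only [mul_pow]
    exact (hL w).integrable_sq.const_mul _
  · have : IntegrableOn (fun w => f w ^ 2 * w) (Ioc 0 u) volume :=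
      ((by fun_prop : Continuous fun w => f w ^ 2 * w).integrableOn_Icc).mono_set Ioc_subset_Icc_self
    refine this.congr ?_
    filter_upwards [ae_restrict_mem measurableSet_Ioc] with w hw
    have h : ∀ ω, ‖(f w * x w ω) ^ 2‖ = f w ^ 2 * x w ω ^ 2 := fun ω => by
      rw [Real.norm_of_nonneg (sq_nonneg _), mul_pow]
    simp_rw [h]
    rw [integral_const_mul, hsq w hw.1.le]

/-- Fubini for the correlation of a square-integrable variable with a path integral. -/
theorem integral_mul_intervalIntegral (hf : Continuous f) (hu : 0 ≤ u)
    (hx : ∀ w, Measurable (x w)) (hc : ∀ ω, Continuous fun w => x w ω)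
    (hL : ∀ w, MemLp (x w) 2 P) (hsq : ∀ w, 0 ≤ w → ∫ ω, x w ω ^ 2 ∂P = w)
    {η : Ω → ℝ} (hη : MemLp η 2 P) :
    ∫ ω, η ω * (∫ w in (0 : ℝ)..u, f w * x w ω) ∂P =
      ∫ w in (0 : ℝ)..u, f w * ∫ ω, η ω * x w ω ∂P := by
  have h1 := memLp_uncurry_of_second_moment (u := u) hf hx hc hL hsq
  have h2 : MemLp (fun p : ℝ × Ω => η p.2) 2 ((volume.restrict (Ioc 0 u)).prod P) :=
    hη.comp_snd _
  have h3 := h2.integrable_mul h1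
  simp_rw [intervalIntegral.integral_of_le hu, ← integral_const_mul]
  rw [integral_integral_swap]
  · refine integral_congr_ae (Eventually.of_forall fun w => ?_)
    exact integral_congr_ae (Eventually.of_forall fun ω => by simp only; ring)
  · exact h3.swap

theorem memLp_intervalIntegral (hf : Continuous f) (hu : 0 ≤ u)
    (hx : ∀ w, Measurable (x w)) (hc : ∀ ω, Continuous fun w => x w ω)
    (hL : ∀ w, MemLp (x w) 2 P) (hsq : ∀ w, 0 ≤ w → ∫ ω, x w ω ^ 2 ∂P = w) :
    MemLp (fun ω => ∫ w in (0 : ℝ)..u, f w * x w ω) 2 P := by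
  rcases hu.eq_or_lt with rfl | hu'
  · simp
  have hm : Measurable fun ω => ∫ w in (0 : ℝ)..u, f w * x w ω :=
    measurable_intervalIntegral_of_continuous hf hu (fun w _ => hx w) hc
  rw [memLp_two_iff_integrable_sq hm.aestronglyMeasurable]
  have h1 := (memLp_uncurry_of_second_moment (u := u) hf hx hc hL hsq).integrable_sq
  have h2 := h1.integral_prod_right.const_mul u
  refine h2.mono' (hm.pow_const 2).aestronglyMeasurable (Eventually.of_forall fun ω => ?_)
  rw [Real.norm_eq_abs, abs_of_nonneg (sq_nonneg _)]
  have := sq_intervalIntegral_le (h := fun w => f w * x w ω) (hf.mul (hc ω)) hu'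
  rwa [intervalIntegral.integral_of_le hu (f := fun w => (f w * x w ω) ^ 2)] at this

/-- A Wiener integral against `e^{κ(u-w)}`, written pathwise by integration by parts, has the
variance predicted by the Itô isometry. -/
theorem integral_sq_wiener (κ : ℝ) (hu : 0 ≤ u)
    (hx : ∀ w, Measurable (x w)) (hc : ∀ ω, Continuous fun w => x w ω)
    (hL : ∀ w, MemLp (x w) 2 P)
    (hcov : ∀ w w', 0 ≤ w → 0 ≤ w' → ∫ ω, x w ω * x w' ω ∂P = min w w') :
    ∫ ω, (x u ω + ∫ w in (0 : ℝ)..u, κ * Real.exp (κ * (u - w)) * x w ω) ^ 2 ∂P =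
      ∫ w in (0 : ℝ)..u, Real.exp (2 * κ * w) := by
  have hsq : ∀ w, 0 ≤ w → ∫ ω, x w ω ^ 2 ∂P = w := fun w hw => by
    simpa [sq] using hcov w w hw hw
  have hf : Continuous fun w => κ * Real.exp (κ * (u - w)) := by fun_prop
  set J : Ω → ℝ := fun ω => ∫ w in (0 : ℝ)..u, κ * Real.exp (κ * (u - w)) * x w ω with hJ
  have hJL : MemLp J 2 P := memLp_intervalIntegral hf hu hx hc hL hsq
  have hξL : MemLp (fun ω => x u ω + J ω) 2 P := (hL u).add hJL
  have hcross : ∀ w ∈ Icc 0 u, ∫ ω, (x u ω + J ω) * x w ω ∂P =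
      ∫ v in (0 : ℝ)..w, Real.exp (κ * (u - v)) := by
    intro w hw
    have h1 : ∫ ω, x w ω * J ω ∂P = ∫ v in (0 : ℝ)..u, κ * Real.exp (κ * (u - v)) * min v w := by
      rw [hJ, integral_mul_intervalIntegral hf hu hx hc hL hsq (hL w)]
      refine intervalIntegral.integral_congr fun v hv => ?_
      rw [uIcc_of_le hu] at hv
      rw [hcov w v hw.1 hv.1, min_comm]
    rw [← kernel_covariance κ hw.1 hw.2, ← h1]
    simp_rw [add_mul, mul_comm (J _)]
    rw [integral_add (f := fun ω => x u ω * x w ω) (g := fun ω => x w ω * J ω)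
      ((hL u).integrable_mul (hL w)) ((hL w).integrable_mul hJL), hcov u w hu hw.1, min_eq_right hw.2]
  have h2 : ∫ ω, (x u ω + J ω) * J ω ∂P =
      ∫ w in (0 : ℝ)..u, κ * Real.exp (κ * (u - w)) *
        ∫ v in (0 : ℝ)..w, Real.exp (κ * (u - v)) := by
    rw [hJ, integral_mul_intervalIntegral hf hu hx hc hL hsq hξL]
    refine intervalIntegral.integral_congr fun v hv => ?_
    rw [uIcc_of_le hu] at hv
    rw [hcross v hv]
  have h3 : ∀ ω, (x u ω + J ω) ^ 2 = (x u ω + J ω) * x u ω + (x u ω + J ω) * J ω := fun ω => by ring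
  rw [integral_congr_ae (Eventually.of_forall h3)]
  rw [integral_add (f := fun ω => (x u ω + J ω) * x u ω) (g := fun ω => (x u ω + J ω) * J ω)
    (hξL.integrable_mul (hL u)) (hξL.integrable_mul hJL), h2,
    hcross u ⟨hu, le_rfl⟩, kernel_variance]

end Moments

/-! ### Independence of three σ-algebras -/

/-- Regrouping of independent σ-algebras: if `m₁ ⟂ m₂` and `m₁ ⊔ m₂ ⟂ m₃`, then
`m₁ ⟂ m₂ ⊔ m₃`. -/
theorem indep_sup_of_indep {Ω : Type*} {m₁ m₂ m₃ m : MeasurableSpace Ω} {P : Measure Ω}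
    [IsProbabilityMeasure P] (h₁ : m₁ ≤ m) (h₂ : m₂ ≤ m) (h₃ : m₃ ≤ m)
    (h₁₂ : Indep m₁ m₂ P) (h₁₂₃ : Indep (m₁ ⊔ m₂) m₃ P) : Indep m₁ (m₂ ⊔ m₃) P := by
  let p : Set (Set Ω) := {s | ∃ a b, MeasurableSet[m₂] a ∧ MeasurableSet[m₃] b ∧ s = a ∩ b}
  have hp : IsPiSystem p := by
    rintro _ ⟨a, b, ha, hb, rfl⟩ _ ⟨a', b', ha', hb', rfl⟩ -
    exact ⟨a ∩ a', b ∩ b', ha.inter ha', hb.inter hb', by ext; simp; tauto⟩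
  have hgen : m₂ ⊔ m₃ = MeasurableSpace.generateFrom p := by
    apply le_antisymm
    · refine sup_le (fun s hs => ?_) fun s hs => ?_
      · exact MeasurableSpace.measurableSet_generateFrom ⟨s, univ, hs, .univ, by simp⟩
      · exact MeasurableSpace.measurableSet_generateFrom ⟨univ, s, .univ, hs, by simp⟩
    · refine MeasurableSpace.generateFrom_le ?_
      rintro _ ⟨a, b, ha, hb, rfl⟩
      exact MeasurableSet.inter ((le_sup_left : m₂ ≤ m₂ ⊔ m₃) _ ha)
        ((le_sup_right : m₃ ≤ m₂ ⊔ m₃) _ hb)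
  refine IndepSets.indep h₁ (sup_le h₂ h₃) (@MeasurableSpace.isPiSystem_measurableSet Ω m₁) hp
    (@MeasurableSpace.generateFrom_measurableSet Ω m₁).symm hgen ?_
  rw [IndepSets_iff]
  rintro s _ hs ⟨a, b, ha, hb, rfl⟩
  rw [Indep_iff] at h₁₂ h₁₂₃
  have hs' : MeasurableSet[m₁ ⊔ m₂] s := (le_sup_left : m₁ ≤ m₁ ⊔ m₂) _ hs
  have ha' : MeasurableSet[m₁ ⊔ m₂] a := (le_sup_right : m₂ ≤ m₁ ⊔ m₂) _ ha
  rw [← inter_assoc, h₁₂₃ _ _ (hs'.inter ha') hb, h₁₂ _ _ hs ha, h₁₂₃ _ _ ha' hb, mul_assoc]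

theorem comap_process {Ω ι : Type*} (x : ι → Ω → ℝ) :
    MeasurableSpace.comap (fun ω i => x i ω) MeasurableSpace.pi =
      ⨆ i, MeasurableSpace.comap (x i) inferInstance := by
  simp only [MeasurableSpace.pi, MeasurableSpace.comap_iSup, MeasurableSpace.comap_comp]
  rfl

namespace Environment

variable {Ω : Type u} [MeasurableSpace Ω] {P : Measure Ω}

/-! ### The driving noise and the shocks to the state -/

/-- The driving noise recovered from the state path. It agrees almost surely with `Z`, and unlike
`Z` it has continuous paths for every `ω`, so that the state equation holds surely. -/
noncomputable def noise (E : Environment Ω P) (t : ℝ≥0) (ω : Ω) : ℝ :=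
  (E.θ t ω - E.θ 0 ω - E.κ * ∫ s in (0 : ℝ)..(t : ℝ), E.θ s.toNNReal ω) / E.σ

/-- The increment of the noise over `[t, t + w]`, with `w` a real number. -/
noncomputable def noiseIncr (E : Environment Ω P) (t : ℝ≥0) (w : ℝ) (ω : Ω) : ℝ :=
  E.noise (t + w.toNNReal) ω - E.noise t ω

/-- The unpredictable part of `θ_{t+u}` given the state up to time `t`. -/
noncomputable def shock (E : Environment Ω P) (t u : ℝ≥0) (ω : Ω) : ℝ :=
  E.θ (t + u) ω - Real.exp (E.κ * u) * E.θ t ω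

variable (E : Environment Ω P)

theorem continuous_θ_toNNReal (ω : Ω) : Continuous fun s : ℝ => E.θ s.toNNReal ω :=
  (E.continuous_θ ω).comp continuous_real_toNNReal

theorem continuous_noise (ω : Ω) : Continuous fun t => E.noise t ω := by
  have h1 : Continuous fun t : ℝ => ∫ s in (0 : ℝ)..t, E.θ s.toNNReal ω :=
    continuous_iff_continuousAt.2 fun t =>
      (hasDerivAt_primitive (E.continuous_θ_toNNReal ω) t).continuousAt
  have h2 : Continuous fun t : ℝ≥0 => ∫ s in (0 : ℝ)..(t : ℝ), E.θ s.toNNReal ω :=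
    h1.comp NNReal.continuous_coe
  have h3 := E.continuous_θ ω
  unfold noise
  fun_prop

theorem measurable_noise (t : ℝ≥0) : Measurable (E.noise t) := by
  have h : Measurable fun ω => ∫ s in (0 : ℝ)..(t : ℝ), (1 : ℝ) * E.θ s.toNNReal ω :=
    measurable_intervalIntegral_of_continuous continuous_const t.coe_nonneg
      (fun w _ => E.measurable_θ _) E.continuous_θ_toNNReal
  simp only [one_mul] at h
  exact (((E.measurable_θ t).sub (E.measurable_θ 0)).sub (h.const_mul _)).div_const _

theorem noise_ae_eq : ∀ᵐ ω ∂P, ∀ t, E.Z t ω = E.noise t ω := by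
  filter_upwards [E.sde] with ω hω t
  rw [noise, hω t]
  field_simp [E.σ_pos.ne']
  ring

theorem isPreBrownianReal_noise : IsPreBrownianReal E.noise P :=
  E.brownian_Z.toIsPreBrownianReal.congr fun t => E.noise_ae_eq.mono fun _ h => h t

theorem continuous_noiseIncr (t : ℝ≥0) (ω : Ω) : Continuous fun w => E.noiseIncr t w ω :=
  ((E.continuous_noise ω).comp (continuous_const.add continuous_real_toNNReal)).sub continuous_const

theorem measurable_noiseIncr (t : ℝ≥0) (w : ℝ) : Measurable (E.noiseIncr t w) :=
  (E.measurable_noise _).sub (E.measurable_noise _)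

/-- The state equation restarted at time `t`. -/
theorem θ_add (t : ℝ≥0) {w : ℝ} (hw : 0 ≤ w) (ω : Ω) :
    E.θ (t + w.toNNReal) ω = E.θ t ω + E.κ * (∫ v in (0 : ℝ)..w, E.θ (t + v.toNNReal) ω) +
      E.σ * E.noiseIncr t w ω := by
  have hσ := E.σ_pos.ne'
  have hc := E.continuous_θ_toNNReal ω
  have h1 : ∫ v in (0 : ℝ)..w, E.θ (t + v.toNNReal) ω =
      ∫ s in (t : ℝ)..(t + w : ℝ), E.θ s.toNNReal ω := by
    have := intervalIntegral.integral_comp_add_left (a := 0) (b := w)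
      (fun s => E.θ s.toNNReal ω) (t : ℝ)
    rw [add_zero] at this
    rw [← this]
    refine intervalIntegral.integral_congr fun v hv => ?_
    rw [uIcc_of_le hw] at hv
    rw [Real.toNNReal_add t.coe_nonneg hv.1, Real.toNNReal_coe]
  have h2 := intervalIntegral.integral_add_adjacent_intervals (a := 0) (b := (t : ℝ))
    (c := (t + w : ℝ)) (hc.intervalIntegrable (μ := volume) _ _) (hc.intervalIntegrable _ _)
  rw [noiseIncr, noise, noise, h1, NNReal.coe_add, Real.coe_toNNReal w hw, ← h2]
  field_simp
  ring

/-- The shock is a Wiener integral of the noise after time `t`. -/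
theorem shock_eq (t u : ℝ≥0) (ω : Ω) :
    E.shock t u ω = E.σ * (E.noiseIncr t u ω +
      ∫ w in (0 : ℝ)..(u : ℝ), E.κ * Real.exp (E.κ * (u - w)) * E.noiseIncr t w ω) := by
  have hy : Continuous fun w : ℝ => E.θ (t + w.toNNReal) ω :=
    (E.continuous_θ ω).comp (continuous_const.add continuous_real_toNNReal)
  have h := variation_of_constants (κ := E.κ) (y₀ := E.θ t ω) (u := u)
    (x := fun w => E.σ * E.noiseIncr t w ω) hy u.coe_nonneg (fun w hw => E.θ_add t hw.1 ω)
  simp only [Real.toNNReal_coe] at h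
  rw [shock, h, mul_add, ← intervalIntegral.integral_const_mul]
  simp only [mul_left_comm]
  ring

theorem measurable_shock (t u : ℝ≥0) : Measurable (E.shock t u) :=
  (E.measurable_θ _).sub ((E.measurable_θ _).const_mul _)

theorem θ_eq_shock (u : ℝ≥0) (ω : Ω) :
    E.θ u ω = Real.exp (E.κ * u) * E.θ 0 ω + E.shock 0 u ω := by
  simp [shock]

/-! ### Moments of the shocks -/

section Moments

theorem memLp_noiseIncr [IsProbabilityMeasure P] (t : ℝ≥0) (w : ℝ) :
    MemLp (E.noiseIncr t w) 2 P :=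
  ((E.isPreBrownianReal_noise.shift t).hasLaw_eval w.toNNReal).hasGaussianLaw.memLp_two

theorem integral_noiseIncr (t : ℝ≥0) (w : ℝ) : ∫ ω, E.noiseIncr t w ω ∂P = 0 :=
  (E.isPreBrownianReal_noise.shift t).integral_eval w.toNNReal

variable [IsProbabilityMeasure P]

theorem integral_noiseIncr_mul (t : ℝ≥0) {w w' : ℝ} (hw : 0 ≤ w) (hw' : 0 ≤ w') :
    ∫ ω, E.noiseIncr t w ω * E.noiseIncr t w' ω ∂P = min w w' := by
  have h := (E.isPreBrownianReal_noise.shift t).covariance_eval w.toNNReal w'.toNNReal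
  have h2 := covariance_eq_sub (E.memLp_noiseIncr t w) (E.memLp_noiseIncr t w')
  rw [E.integral_noiseIncr, zero_mul, sub_zero] at h2
  have h3 : cov[E.noiseIncr t w, E.noiseIncr t w'; P] = min w w' := by
    refine h.trans ?_
    simp [NNReal.coe_min, hw, hw']
  exact h2.symm.trans h3

theorem integral_noiseIncr_sq (t : ℝ≥0) {w : ℝ} (hw : 0 ≤ w) :
    ∫ ω, E.noiseIncr t w ω ^ 2 ∂P = w := by
  simpa [sq] using E.integral_noiseIncr_mul t hw hw

theorem continuous_exp_kernel (κ u : ℝ) : Continuous fun w => κ * Real.exp (κ * (u - w)) := by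
  fun_prop

theorem memLp_shock (t u : ℝ≥0) : MemLp (E.shock t u) 2 P := by
  have h := memLp_intervalIntegral (continuous_exp_kernel E.κ u) u.coe_nonneg
    (E.measurable_noiseIncr t) (E.continuous_noiseIncr t) (E.memLp_noiseIncr t)
    (fun w hw => E.integral_noiseIncr_sq t hw)
  have h2 := ((E.memLp_noiseIncr t u).add h).const_mul E.σ
  rw [show E.shock t u = _ from funext (E.shock_eq t u)]
  exact h2

theorem integral_shock (t u : ℝ≥0) : ∫ ω, E.shock t u ω ∂P = 0 := by
  have h := memLp_intervalIntegral (continuous_exp_kernel E.κ u) u.coe_nonneg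
    (E.measurable_noiseIncr t) (E.continuous_noiseIncr t) (E.memLp_noiseIncr t)
    (fun w hw => E.integral_noiseIncr_sq t hw)
  have h1 := integral_mul_intervalIntegral (continuous_exp_kernel E.κ u) u.coe_nonneg
    (E.measurable_noiseIncr t) (E.continuous_noiseIncr t) (E.memLp_noiseIncr t)
    (fun w hw => E.integral_noiseIncr_sq t hw) (memLp_const (1 : ℝ))
  simp only [one_mul, E.integral_noiseIncr, mul_zero, intervalIntegral.integral_zero] at h1
  simp only [E.shock_eq]
  rw [integral_const_mul, integral_add ((E.memLp_noiseIncr t u).integrable one_le_two)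
    (h.integrable one_le_two), h1, E.integral_noiseIncr]
  simp

theorem integral_shock_sq (t u : ℝ≥0) :
    ∫ ω, E.shock t u ω ^ 2 ∂P = E.σ ^ 2 * ∫ x in (0 : ℝ)..(u : ℝ), Real.exp (2 * E.κ * x) := by
  rw [← integral_sq_wiener E.κ u.coe_nonneg (E.measurable_noiseIncr t) (E.continuous_noiseIncr t)
    (E.memLp_noiseIncr t) (fun w w' hw hw' => E.integral_noiseIncr_mul t hw hw'),
    ← integral_const_mul]
  simp only [E.shock_eq, mul_pow]

theorem memLp_θ (t : ℝ≥0) : MemLp (E.θ t) 2 P := by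
  have h0 : MemLp (E.θ 0) 2 P := by
    have h1 : MemLp id 2 (P.map (E.θ 0)) := by
      rw [E.law_θ_zero.map_eq]
      exact memLp_id_gaussianReal 2
    exact h1.comp_of_map (E.measurable_θ 0).aemeasurable
  rw [show E.θ t = _ from funext (E.θ_eq_shock t)]
  exact (h0.const_mul _).add (E.memLp_shock 0 t)

end Moments

/-! ### Independence of the shocks from the sender's information -/

theorem measurable_noiseIncr_shift (t : ℝ≥0) (w : ℝ) :
    Measurable[⨆ s : ℝ≥0, MeasurableSpace.comap (fun ω => E.noise (t + s) ω - E.noise t ω)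
      inferInstance] (E.noiseIncr t w) :=
  (comap_measurable (E.noiseIncr t w)).mono (le_iSup (fun s : ℝ≥0 =>
    MeasurableSpace.comap (fun ω => E.noise (t + s) ω - E.noise t ω) inferInstance) w.toNNReal)
    le_rfl

/-- The shock is determined by the increments of the noise up to the terminal time. -/
theorem measurable_shock_of_noiseIncr {Ω : Type u} {m : MeasurableSpace Ω}
    [MeasurableSpace Ω] {P : Measure Ω} (E : Environment Ω P) (t u : ℝ≥0)
    (h : ∀ w ∈ Icc (0 : ℝ) u, Measurable[m] (E.noiseIncr t w)) : Measurable[m] (E.shock t u) := by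
  rw [show E.shock t u = _ from funext (E.shock_eq t u)]
  exact ((h u ⟨u.coe_nonneg, le_rfl⟩).add (measurable_intervalIntegral_of_continuous
    (continuous_exp_kernel E.κ u) u.coe_nonneg h (E.continuous_noiseIncr t))).const_mul _

theorem measurable_θ_of_noise {Ω : Type u} {m : MeasurableSpace Ω} [MeasurableSpace Ω]
    {P : Measure Ω} (E : Environment Ω P) (t : ℝ≥0) (h0 : Measurable[m] (E.θ 0))
    (hn : ∀ v ≤ t, Measurable[m] (E.noise v)) : Measurable[m] (E.θ t) := by
  rw [show E.θ t = _ from funext (E.θ_eq_shock t)]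
  refine (h0.const_mul _).add (E.measurable_shock_of_noiseIncr 0 t fun w hw => ?_)
  refine (hn _ ?_).sub (hn 0 (zero_le))
  rw [zero_add]
  exact Real.toNNReal_le_iff_le_coe.2 hw.2

theorem measurable_θ_past {s t : ℝ≥0} (hs : s ≤ t) :
    Measurable[(⨆ i : Iic t, MeasurableSpace.comap (E.noise i) inferInstance) ⊔
      MeasurableSpace.comap (E.θ 0) inferInstance] (E.θ s) :=
  E.measurable_θ_of_noise s ((comap_measurable (E.θ 0)).mono le_sup_right le_rfl) fun v hv =>
    (comap_measurable (E.noise v)).mono ((le_iSup (fun i : Iic t =>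
      MeasurableSpace.comap (E.noise i) inferInstance) ⟨v, hv.trans hs⟩).trans le_sup_left) le_rfl

theorem indep_shift_past [IsProbabilityMeasure P] (t : ℝ≥0) :
    Indep (⨆ s : ℝ≥0, MeasurableSpace.comap (fun ω => E.noise (t + s) ω - E.noise t ω)
        inferInstance)
      ((⨆ i : Iic t, MeasurableSpace.comap (E.noise i) inferInstance) ⊔
        MeasurableSpace.comap (E.θ 0) inferInstance) P := by
  have h1 := E.isPreBrownianReal_noise.indepFun_shift t
  rw [IndepFun_iff_Indep, comap_process, comap_process (fun (i : Iic t) ω => E.noise i ω)] at h1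
  have h2 : IndepFun (fun ω t => E.noise t ω) (E.θ 0) P :=
    E.indep_θ_zero_Z.symm.congr (E.noise_ae_eq.mono fun ω h => funext h) (ae_eq_refl _)
  rw [IndepFun_iff_Indep, comap_process] at h2
  have hn : ∀ s, Measurable[⨆ i, MeasurableSpace.comap (E.noise i) inferInstance] (E.noise s) :=
    fun s => (comap_measurable (E.noise s)).mono
      (le_iSup (fun i => MeasurableSpace.comap (E.noise i) inferInstance) s) le_rfl
  refine indep_sup_of_indep ?_ ?_ (E.measurable_θ 0).comap_le h1 (indep_of_indep_of_le_left h2 ?_)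
  · exact iSup_le fun s => ((E.measurable_noise _).sub (E.measurable_noise _)).comap_le
  · exact iSup_le fun s => (E.measurable_noise _).comap_le
  · refine sup_le (iSup_le fun s => ?_) (iSup_le fun s => (hn _).comap_le)
    exact ((hn _).sub (hn _)).comap_le

theorem senderInfo_le (t : ℝ≥0) : E.senderInfo t ≤ ‹MeasurableSpace Ω› :=
  sup_le (iSup_le fun s => (E.measurable_Y s).comap_le)
    (iSup₂_le fun s _ => (E.measurable_θ s).comap_le)

/-- Shocks after time `t` are independent of everything the sender knows at time `t`: the noise
has independent increments and is independent of `θ₀`, and `Y` is independent of the state. -/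
theorem indep_shock_senderInfo [IsProbabilityMeasure P] (t u : ℝ≥0) :
    Indep (MeasurableSpace.comap (E.shock t u) inferInstance) (E.senderInfo t) P := by
  have hθ : ∀ s, Measurable[⨆ i, MeasurableSpace.comap (E.θ i) inferInstance] (E.θ s) :=
    fun s => (comap_measurable (E.θ s)).mono
      (le_iSup (fun i => MeasurableSpace.comap (E.θ i) inferInstance) s) le_rfl
  have h1 : Indep (MeasurableSpace.comap (E.shock t u) inferInstance)
      (⨆ (s : ℝ≥0) (_ : s ≤ t), MeasurableSpace.comap (E.θ s) inferInstance) P := by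
    refine indep_of_indep_of_le (E.indep_shift_past t) ?_ ?_
    · exact (E.measurable_shock_of_noiseIncr t u
        fun w _ => E.measurable_noiseIncr_shift t w).comap_le
    · exact iSup₂_le fun s hs => (E.measurable_θ_past hs).comap_le
  have h2 := E.indep_Y_θ.symm
  rw [IndepFun_iff_Indep, comap_process, comap_process] at h2
  rw [senderInfo, sup_comm]
  refine indep_sup_of_indep (E.measurable_shock t u).comap_le ?_ ?_ h1
    (indep_of_indep_of_le_left h2 ?_)
  · exact iSup₂_le fun s _ => (E.measurable_θ s).comap_le
  · exact iSup_le fun s => (E.measurable_Y s).comap_le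
  · refine sup_le ?_ (iSup₂_le fun s _ => (hθ s).comap_le)
    exact ((hθ _).sub ((hθ _).const_mul _)).comap_le

end Environment

/-! ### Discounted integrals -/

theorem setLIntegral_Ioi_comp_sub (F : ℝ → ℝ≥0∞) (t : ℝ) :
    ∫⁻ s in Ioi t, F (s - t) = ∫⁻ u in Ioi (0 : ℝ), F u := by
  rw [← lintegral_indicator measurableSet_Ioi, ← lintegral_indicator measurableSet_Ioi,
    ← lintegral_sub_right_eq_self ((Ioi (0 : ℝ)).indicator F) t]
  refine lintegral_congr fun s => ?_
  simp [indicator]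

theorem setLIntegral_exp_neg {b : ℝ} (hb : 0 < b) (x : ℝ) {c : ℝ} (hc : 0 ≤ c) :
    ∫⁻ u in Ioi x, ENNReal.ofReal (c * Real.exp (-b * u)) =
      ENNReal.ofReal (c * Real.exp (-b * x) / b) := by
  rw [← ofReal_integral_eq_lintegral_ofReal]
  · rw [integral_const_mul, integral_exp_mul_Ioi (by linarith)]
    congr 1
    field_simp
  · exact (integrableOn_exp_mul_Ioi (by linarith) x).const_mul c
  · exact Eventually.of_forall fun u => by positivity

/-- The discounted integral of the variance of the shocks, by exchanging the order of
integration. -/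
theorem setLIntegral_discounted_variance {r κ : ℝ} (hr : 0 < r) (hκ : 2 * κ < r) {c : ℝ}
    (hc : 0 ≤ c) :
    ∫⁻ u in Ioi (0 : ℝ), ENNReal.ofReal (r * Real.exp (-r * u)) *
        ENNReal.ofReal (c * ∫ x in (0 : ℝ)..u, Real.exp (2 * κ * x)) =
      ENNReal.ofReal (c / (r - 2 * κ)) := by
  have hcont : Continuous fun x => c * Real.exp (2 * κ * x) := by fun_prop
  have h1 : ∀ u ∈ Ioi (0 : ℝ), ENNReal.ofReal (r * Real.exp (-r * u)) *
        ENNReal.ofReal (c * ∫ x in (0 : ℝ)..u, Real.exp (2 * κ * x)) =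
      ∫⁻ x in Ioi (0 : ℝ), (Ici x).indicator (fun u => ENNReal.ofReal (r * Real.exp (-r * u))) u *
        ENNReal.ofReal (c * Real.exp (2 * κ * x)) := by
    intro u hu
    rw [← intervalIntegral.integral_const_mul, intervalIntegral.integral_of_le (le_of_lt hu),
      ofReal_integral_eq_lintegral_ofReal
        (hcont.integrableOn_Icc.mono_set Ioc_subset_Icc_self)
        (Eventually.of_forall fun x => by positivity),
      ← lintegral_const_mul _ (by fun_prop), ← Ioi_inter_Iic, inter_comm,
      ← Measure.restrict_restrict measurableSet_Iic, ← lintegral_indicator measurableSet_Iic]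
    refine lintegral_congr fun x => ?_
    by_cases hx : x ≤ u <;> simp [indicator, hx]
  rw [setLIntegral_congr_fun measurableSet_Ioi h1, lintegral_lintegral_swap]
  · have h2 : ∀ x ∈ Ioi (0 : ℝ), ∫⁻ u in Ioi (0 : ℝ),
          (Ici x).indicator (fun u => ENNReal.ofReal (r * Real.exp (-r * u))) u *
            ENNReal.ofReal (c * Real.exp (2 * κ * x)) =
        ENNReal.ofReal (c * Real.exp (-(r - 2 * κ) * x)) := by
      intro x hx
      rw [lintegral_mul_const _ (Measurable.indicator (by fun_prop) measurableSet_Ici),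
        lintegral_indicator measurableSet_Ici, Measure.restrict_restrict measurableSet_Ici,
        inter_eq_self_of_subset_left (Ici_subset_Ioi.2 hx), setLIntegral_congr Ioi_ae_eq_Ici.symm,
        setLIntegral_exp_neg hr x hr.le, ← ENNReal.ofReal_mul (by positivity)]
      congr 1
      rw [mul_div_assoc, mul_div_left_comm, div_self hr.ne', mul_one, mul_left_comm, ← Real.exp_add]
      ring_nf
    rw [setLIntegral_congr_fun measurableSet_Ioi h2, setLIntegral_exp_neg (by linarith) 0 hc]
    simp
  · refine Measurable.aemeasurable ?_
    have h3 : Measurable fun p : ℝ × ℝ => {p : ℝ × ℝ | p.2 ≤ p.1}.indicator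
        (fun p => ENNReal.ofReal (r * Real.exp (-r * p.1))) p :=
      Measurable.indicator (by fun_prop) (measurableSet_le measurable_snd measurable_fst)
    refine Measurable.mul ?_ (by fun_prop)
    exact h3

/-- The value of a quadratic loss with mean-square prediction error `e^{2κu} a + v(u) p` at
horizon `u`. -/
theorem setLIntegral_discounted_loss {r κ c : ℝ} (hr : 0 < r) (hκ : 2 * κ < r) (hc : 0 ≤ c) (t : ℝ)
    (a p : ℝ≥0∞) :
    ∫⁻ s in Ioi t, ENNReal.ofReal (r * Real.exp (-r * (s - t))) *
        (ENNReal.ofReal (Real.exp (2 * κ * (s - t))) * a +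
          ENNReal.ofReal (c * ∫ x in (0 : ℝ)..(s - t), Real.exp (2 * κ * x)) * p) =
      ENNReal.ofReal (r / (r - 2 * κ)) * a + ENNReal.ofReal (c / (r - 2 * κ)) * p := by
  rw [setLIntegral_Ioi_comp_sub (fun u => ENNReal.ofReal (r * Real.exp (-r * u)) *
        (ENNReal.ofReal (Real.exp (2 * κ * u)) * a +
          ENNReal.ofReal (c * ∫ x in (0 : ℝ)..u, Real.exp (2 * κ * x)) * p)) t]
  have hm : Measurable fun u : ℝ => ∫ x in (0 : ℝ)..u, Real.exp (2 * κ * x) :=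
    (continuous_iff_continuousAt.2 fun u => (hasDerivAt_primitive
      (y := fun x => Real.exp (2 * κ * x)) (by fun_prop) u).continuousAt).measurable
  simp_rw [mul_add, ← mul_assoc]
  rw [lintegral_add_left (by fun_prop), lintegral_mul_const _ (by fun_prop),
    lintegral_mul_const _ (by fun_prop), setLIntegral_discounted_variance hr hκ hc]
  congr 2
  have h : ∀ u : ℝ, ENNReal.ofReal (r * Real.exp (-r * u)) * ENNReal.ofReal (Real.exp (2 * κ * u)) =
      ENNReal.ofReal (r * Real.exp (-(r - 2 * κ) * u)) := fun u => by
    rw [← ENNReal.ofReal_mul (by positivity), mul_assoc, ← Real.exp_add]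
    ring_nf
  simp_rw [h]
  rw [setLIntegral_exp_neg (by linarith) 0 hr.le]
  simp

namespace Environment

/-! ### Mean-square prediction of the state -/

section Prediction

variable {Ω : Type u} {𝒢 : MeasurableSpace Ω} [mΩ : MeasurableSpace Ω] {P : Measure Ω}
  [IsProbabilityMeasure P] (E : Environment Ω P) {t : ℝ≥0}

/-- The forecast error `θ_{t+u} - e^{κu} E[θ_t | 𝒢]` (see `predError_eq`), written as the error about
`θ_t` carried forward plus the shock. -/
noncomputable def predError {Ω : Type u} (𝒢 : MeasurableSpace Ω) [MeasurableSpace Ω]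
    {P : Measure Ω} (E : Environment Ω P) (t u : ℝ≥0) (ω : Ω) : ℝ :=
  Real.exp (E.κ * u) * (E.θ t ω - (P[E.θ t|𝒢]) ω) + E.shock t u ω

omit [IsProbabilityMeasure P] in
theorem predError_eq (u : ℝ≥0) (ω : Ω) :
    E.predError 𝒢 t u ω = E.θ (t + u) ω - Real.exp (E.κ * u) * (P[E.θ t|𝒢]) ω := by
  rw [predError, shock]
  ring

theorem memLp_sub_condExp (t : ℝ≥0) : MemLp (fun ω => E.θ t ω - (P[E.θ t|𝒢]) ω) 2 P :=
  (E.memLp_θ t).sub ((E.memLp_θ t).condExp one_le_two)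

theorem memLp_predError (u : ℝ≥0) : MemLp (E.predError 𝒢 t u) 2 P :=
  ((E.memLp_sub_condExp t).const_mul _).add (E.memLp_shock t u)

theorem integral_mul_shock (u : ℝ≥0) {V : Ω → ℝ} (hV : Measurable[E.senderInfo t] V) :
    ∫ ω, V ω * E.shock t u ω ∂P = 0 := by
  have h : IndepFun V (E.shock t u) P := by
    rw [IndepFun_iff_Indep]
    exact (indep_of_indep_of_le_right (E.indep_shock_senderInfo t u) hV.comap_le).symm
  rw [h.integral_fun_mul_eq_mul_integral
    (hV.mono (E.senderInfo_le t) le_rfl).aestronglyMeasurable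
    (E.measurable_shock t u).aestronglyMeasurable, E.integral_shock, mul_zero]

theorem setIntegral_shock_sq (u : ℝ≥0) {G : Set Ω} (hG : MeasurableSet[E.senderInfo t] G) :
    ∫ ω in G, E.shock t u ω ^ 2 ∂P =
      E.σ ^ 2 * (∫ x in (0 : ℝ)..(u : ℝ), Real.exp (2 * E.κ * x)) * P.real G := by
  have hV : Measurable[E.senderInfo t] (G.indicator fun _ => (1 : ℝ)) :=
    measurable_const.indicator hG
  have h : IndepFun (G.indicator fun _ => (1 : ℝ)) (fun ω => E.shock t u ω ^ 2) P := by
    have h0 : IndepFun (G.indicator fun _ => (1 : ℝ)) (E.shock t u) P := by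
      rw [IndepFun_iff_Indep]
      exact (indep_of_indep_of_le_right (E.indep_shock_senderInfo t u) hV.comap_le).symm
    exact h0.comp (φ := id) (ψ := fun x => x ^ 2) measurable_id (by fun_prop)
  have hG' := E.senderInfo_le t _ hG
  have h1 := h.integral_fun_mul_eq_mul_integral
    (hV.mono (E.senderInfo_le t) le_rfl).aestronglyMeasurable
    ((E.measurable_shock t u).pow_const 2).aestronglyMeasurable
  rw [integral_indicator hG', E.integral_shock_sq, setIntegral_const, smul_eq_mul, mul_one,
    mul_comm] at h1
  rw [← h1, ← integral_indicator hG']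
  refine integral_congr_ae (Eventually.of_forall fun ω => ?_)
  by_cases hω : ω ∈ G <;> simp [hω]

/-- Orthogonality of the prediction error to square-integrable functions of the information. -/
theorem integral_mul_predError (h𝒢 : 𝒢 ≤ E.senderInfo t) (u : ℝ≥0) {V : Ω → ℝ}
    (hV : Measurable[𝒢] V) (hVL : MemLp V 2 P) : ∫ ω, V ω * E.predError 𝒢 t u ω ∂P = 0 := by
  have h𝒢' := h𝒢.trans (E.senderInfo_le t)
  have hθ := E.memLp_θ t
  have hm : MemLp (P[E.θ t|𝒢]) 2 P := hθ.condExp one_le_two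
  have h1 : ∫ ω, V ω * (P[E.θ t|𝒢]) ω ∂P = ∫ ω, V ω * E.θ t ω ∂P := by
    have := condExp_mul_of_stronglyMeasurable_left (μ := P) (m := 𝒢) (g := E.θ t)
      hV.stronglyMeasurable (hVL.integrable_mul hθ) (hθ.integrable one_le_two)
    exact (integral_congr_ae this.symm).trans (integral_condExp h𝒢')
  have h2 : ∀ ω, V ω * E.predError 𝒢 t u ω = Real.exp (E.κ * u) * (V ω * E.θ t ω) -
      Real.exp (E.κ * u) * (V ω * (P[E.θ t|𝒢]) ω) + V ω * E.shock t u ω := fun ω => by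
    rw [predError]
    ring
  have i1 : Integrable (fun ω => Real.exp (E.κ * u) * (V ω * E.θ t ω)) P :=
    (hVL.integrable_mul hθ).const_mul _
  have i2 : Integrable (fun ω => Real.exp (E.κ * u) * (V ω * (P[E.θ t|𝒢]) ω)) P :=
    (hVL.integrable_mul hm).const_mul _
  have i3 : Integrable (fun ω => V ω * E.shock t u ω) P := hVL.integrable_mul (E.memLp_shock t u)
  have i12 : Integrable (fun ω => Real.exp (E.κ * u) * (V ω * E.θ t ω) -
      Real.exp (E.κ * u) * (V ω * (P[E.θ t|𝒢]) ω)) P := i1.sub i2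
  rw [integral_congr_ae (Eventually.of_forall h2), integral_add i12 i3, integral_sub i1 i2,
    integral_const_mul, integral_const_mul, h1, E.integral_mul_shock u (hV.mono h𝒢 le_rfl)]
  ring

/-- The mean-square prediction error at horizon `u`, on an event of the information. -/
theorem setLIntegral_predError_sq (h𝒢 : 𝒢 ≤ E.senderInfo t) (u : ℝ≥0) {G : Set Ω}
    (hG : MeasurableSet[𝒢] G) :
    ∫⁻ ω in G, ENNReal.ofReal (E.predError 𝒢 t u ω ^ 2) ∂P =
      ENNReal.ofReal (Real.exp (2 * E.κ * u)) *
          (∫⁻ ω in G, ENNReal.ofReal ((E.θ t ω - (P[E.θ t|𝒢]) ω) ^ 2) ∂P) +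
        ENNReal.ofReal (E.σ ^ 2 * ∫ x in (0 : ℝ)..(u : ℝ), Real.exp (2 * E.κ * x)) * P G := by
  set D : Ω → ℝ := fun ω => E.θ t ω - (P[E.θ t|𝒢]) ω with hD
  have hDL : MemLp D 2 P := E.memLp_sub_condExp t
  have hξL := E.memLp_shock t u
  have hG' := E.senderInfo_le t _ (h𝒢 _ hG)
  have hDm : Measurable[E.senderInfo t] D := by
    refine Measurable.sub ?_ (stronglyMeasurable_condExp.measurable.mono h𝒢 le_rfl)
    exact (comap_measurable (E.θ t)).mono ((le_iSup₂ (f := fun (s : ℝ≥0) (_ : s ≤ t) =>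
      MeasurableSpace.comap (E.θ s) inferInstance) t le_rfl).trans le_sup_right) le_rfl
  have hcross : ∫ ω in G, D ω * E.shock t u ω ∂P = 0 := by
    rw [← integral_indicator hG', ← E.integral_mul_shock u (hDm.indicator (h𝒢 _ hG))]
    refine integral_congr_ae (Eventually.of_forall fun ω => ?_)
    by_cases hω : ω ∈ G <;> simp [hω]
  have hexp : ∀ ω, E.predError 𝒢 t u ω ^ 2 = Real.exp (2 * E.κ * u) * D ω ^ 2 +
      (2 * Real.exp (E.κ * u)) * (D ω * E.shock t u ω) + E.shock t u ω ^ 2 := fun ω => by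
    rw [predError, show 2 * E.κ * u = E.κ * u + E.κ * u by ring, Real.exp_add, hD]
    ring
  have i1 : IntegrableOn (fun ω => Real.exp (2 * E.κ * u) * D ω ^ 2) G P :=
    (hDL.integrable_sq.const_mul _).integrableOn
  have i2 : IntegrableOn (fun ω => (2 * Real.exp (E.κ * u)) * (D ω * E.shock t u ω)) G P :=
    ((hDL.integrable_mul hξL).const_mul _).integrableOn
  have i3 : IntegrableOn (fun ω => E.shock t u ω ^ 2) G P := hξL.integrable_sq.integrableOn
  have i12 : IntegrableOn (fun ω => Real.exp (2 * E.κ * u) * D ω ^ 2 +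
      (2 * Real.exp (E.κ * u)) * (D ω * E.shock t u ω)) G P := i1.add i2
  have hv : 0 ≤ ∫ x in (0 : ℝ)..(u : ℝ), Real.exp (2 * E.κ * x) :=
    intervalIntegral.integral_nonneg u.coe_nonneg fun _ _ => by positivity
  rw [← ofReal_integral_eq_lintegral_ofReal (E.memLp_predError u).integrable_sq.integrableOn
      (Eventually.of_forall fun _ => sq_nonneg _),
    ← ofReal_integral_eq_lintegral_ofReal hDL.integrable_sq.integrableOn
      (Eventually.of_forall fun _ => sq_nonneg _),
    integral_congr_ae (Eventually.of_forall hexp), integral_add i12 i3, integral_add i1 i2,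
    integral_const_mul, integral_const_mul, hcross, E.setIntegral_shock_sq u (h𝒢 _ hG), mul_zero,
    add_zero, ENNReal.ofReal_add, ENNReal.ofReal_mul, ENNReal.ofReal_mul (q := P.real G),
    ofReal_measureReal]
  · positivity
  · positivity
  · exact mul_nonneg (by positivity) (integral_nonneg fun _ => sq_nonneg _)
  · positivity

/-- `e^{κu} E[θ_t | 𝒢]` is the best predictor of `θ_{t+u}` among `𝒢`-measurable functions,
square-integrable or not. -/
theorem setLIntegral_predError_sq_le (h𝒢 : 𝒢 ≤ E.senderInfo t) (u : ℝ≥0) {G : Set Ω}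
    (hG : MeasurableSet[𝒢] G) {W : Ω → ℝ} (hW : Measurable[𝒢] (G.indicator W)) :
    ∫⁻ ω in G, ENNReal.ofReal (E.predError 𝒢 t u ω ^ 2) ∂P ≤
      ∫⁻ ω in G, ENNReal.ofReal ((W ω - E.θ (t + u) ω) ^ 2) ∂P := by
  have hG' := E.senderInfo_le t _ (h𝒢 _ hG)
  have h𝒢' := h𝒢.trans (E.senderInfo_le t)
  set h := E.predError 𝒢 t u with hh
  have hL : MemLp h 2 P := E.memLp_predError u
  set V : Ω → ℝ := G.indicator fun ω => W ω - Real.exp (E.κ * u) * (P[E.θ t|𝒢]) ω with hVdef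
  have hV : Measurable[𝒢] V := by
    have : V = fun ω => G.indicator W ω -
        G.indicator (fun ω => Real.exp (E.κ * u) * (P[E.θ t|𝒢]) ω) ω := by
      ext ω
      by_cases hω : ω ∈ G <;> simp [hVdef, hω]
    rw [this]
    exact hW.sub ((stronglyMeasurable_condExp.measurable.const_mul _).indicator hG)
  have hWV : ∀ ω ∈ G, (W ω - E.θ (t + u) ω) ^ 2 = (V ω - h ω) ^ 2 := fun ω hω => by
    rw [hVdef, indicator_of_mem hω, hh, predError_eq]
    ring
  rw [setLIntegral_congr_fun hG' (fun ω hω => congrArg ENNReal.ofReal (hWV ω hω))]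
  by_cases htop : ∫⁻ ω in G, ENNReal.ofReal ((V ω - h ω) ^ 2) ∂P = ∞
  · rw [htop]
    exact le_top
  have hVm : AEStronglyMeasurable V P := (hV.mono h𝒢' le_rfl).aestronglyMeasurable
  have iVh : IntegrableOn (fun ω => (V ω - h ω) ^ 2) G P := by
    refine ⟨((hVm.sub hL.1).pow 2).restrict, ?_⟩
    rw [hasFiniteIntegral_iff_ofReal (Eventually.of_forall fun _ => sq_nonneg _)]
    exact lt_top_iff_ne_top.2 htop
  have hVhL : MemLp (fun ω => V ω - h ω) 2 (P.restrict G) :=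
    (memLp_two_iff_integrable_sq (hVm.sub hL.1).restrict).2 iVh
  have hVG : MemLp V 2 (P.restrict G) := by
    convert hVhL.add (hL.restrict G) using 1
    ext ω
    simp
  have hVL : MemLp V 2 P := by
    rw [hVdef, memLp_indicator_iff_restrict hG']
    refine hVG.ae_eq ?_
    filter_upwards [ae_restrict_mem hG'] with ω hω
    rw [hVdef, indicator_of_mem hω]
  have horth : ∫ ω in G, V ω * h ω ∂P = 0 := by
    rw [← E.integral_mul_predError h𝒢 u hV hVL, ← integral_indicator hG']
    refine integral_congr_ae (Eventually.of_forall fun ω => ?_)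
    by_cases hω : ω ∈ G <;> simp [hω, hVdef, hh]
  rw [← ofReal_integral_eq_lintegral_ofReal hL.integrable_sq.integrableOn
      (Eventually.of_forall fun _ => sq_nonneg _),
    ← ofReal_integral_eq_lintegral_ofReal iVh (Eventually.of_forall fun _ => sq_nonneg _)]
  refine ENNReal.ofReal_le_ofReal ?_
  have hexp : ∀ ω, (V ω - h ω) ^ 2 = V ω ^ 2 - 2 * (V ω * h ω) + h ω ^ 2 := fun ω => by ring
  have i1 : IntegrableOn (fun ω => V ω ^ 2) G P := hVL.integrable_sq.integrableOn
  have i2 : IntegrableOn (fun ω => 2 * (V ω * h ω)) G P :=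
    ((hVL.integrable_mul hL).const_mul 2).integrableOn
  have i12 : IntegrableOn (fun ω => V ω ^ 2 - 2 * (V ω * h ω)) G P := i1.sub i2
  rw [integral_congr_ae (μ := P.restrict G) (Eventually.of_forall hexp),
    integral_add i12 hL.integrable_sq.integrableOn, integral_sub i1 i2, integral_const_mul,
    horth]
  have : 0 ≤ ∫ ω in G, V ω ^ 2 ∂P := integral_nonneg fun _ => sq_nonneg _
  linarith

/-- The bound on the continuation loss in the definition of obedience. -/
noncomputable def lossBound {Ω : Type u} (𝒢 : MeasurableSpace Ω) [MeasurableSpace Ω]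
    {P : Measure Ω} (E : Environment Ω P) (t : ℝ≥0) (ω : Ω) : ℝ≥0∞ :=
  ENNReal.ofReal ((E.σ ^ 2 + E.r * condVar 𝒢 (E.θ t) P ω) / (E.r - 2 * E.κ))

theorem setLIntegral_lossBound (h𝒢 : 𝒢 ≤ E.senderInfo t) {G : Set Ω} (hG : MeasurableSet[𝒢] G) :
    ∫⁻ ω in G, E.lossBound 𝒢 t ω ∂P =
      ENNReal.ofReal (E.r / (E.r - 2 * E.κ)) *
          (∫⁻ ω in G, ENNReal.ofReal ((E.θ t ω - (P[E.θ t|𝒢]) ω) ^ 2) ∂P) +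
        ENNReal.ofReal (E.σ ^ 2 / (E.r - 2 * E.κ)) * P G := by
  have h𝒢' := h𝒢.trans (E.senderInfo_le t)
  have hρ : 0 < E.r - 2 * E.κ := sub_pos.2 E.two_κ_lt_r
  have hr := E.r_pos
  have hD : Integrable (fun ω => (E.θ t ω - (P[E.θ t|𝒢]) ω) ^ 2) P :=
    (E.memLp_sub_condExp (𝒢 := 𝒢) t).integrable_sq
  have hv0 : 0 ≤ᵐ[P] condVar 𝒢 (E.θ t) P := condExp_nonneg (Eventually.of_forall fun ω => sq_nonneg _)
  have h1 : ∫⁻ ω in G, E.lossBound 𝒢 t ω ∂P = ∫⁻ ω in G, (ENNReal.ofReal (E.r / (E.r - 2 * E.κ)) *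
      ENNReal.ofReal (condVar 𝒢 (E.θ t) P ω) + ENNReal.ofReal (E.σ ^ 2 / (E.r - 2 * E.κ))) ∂P := by
    refine lintegral_congr_ae (ae_restrict_of_ae ?_)
    filter_upwards [hv0] with ω hω
    have hω' : 0 ≤ condVar 𝒢 (E.θ t) P ω := hω
    rw [lossBound, ← ENNReal.ofReal_mul (by positivity), ← ENNReal.ofReal_add (by positivity)
      (by positivity)]
    congr 1
    ring
  rw [h1, lintegral_add_right _ measurable_const, lintegral_const_mul', setLIntegral_const,
    ← ofReal_integral_eq_lintegral_ofReal integrable_condVar.integrableOn (ae_restrict_of_ae hv0),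
    setIntegral_condVar (hm := h𝒢') hD hG,
    ofReal_integral_eq_lintegral_ofReal (f := fun ω => (E.θ t ω - (P[E.θ t|𝒢]) ω) ^ 2)
      hD.integrableOn (Eventually.of_forall fun _ => sq_nonneg _)]
  exact ENNReal.ofReal_ne_top

theorem lossBound_integral_ne_top (h𝒢 : 𝒢 ≤ E.senderInfo t) {G : Set Ω}
    (hG : MeasurableSet[𝒢] G) : ∫⁻ ω in G, E.lossBound 𝒢 t ω ∂P ≠ ∞ := by
  rw [E.setLIntegral_lossBound h𝒢 hG]
  have h : ∫⁻ ω in G, ENNReal.ofReal ((E.θ t ω - (P[E.θ t|𝒢]) ω) ^ 2) ∂P ≠ ∞ := by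
    rw [← ofReal_integral_eq_lintegral_ofReal (E.memLp_sub_condExp t).integrable_sq.integrableOn
      (Eventually.of_forall fun _ => sq_nonneg _)]
    exact ENNReal.ofReal_ne_top
  finiteness

end Prediction

end Environment

namespace DecisionRule

variable {Ω : Type u} {𝒢 : MeasurableSpace Ω} [MeasurableSpace Ω] {P : Measure Ω} {E : Environment Ω P}

/-! ### Realized and expected losses of a decision rule -/

theorem info_le_senderInfo (A : DecisionRule E) (t : ℝ≥0) : A.info t ≤ E.senderInfo t :=
  iSup₂_le fun s hs => ((A.adapted s).mono (E.senderInfo_mono hs) le_rfl).comap_le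

theorem measurable_path_info (A : DecisionRule E) {s t : ℝ≥0} (hs : s ≤ t) :
    Measurable[A.info t] fun ω => A.path ω s :=
  (comap_measurable fun ω => A.path ω s).mono (le_iSup₂ (f := fun (s : ℝ≥0) (_ : s ≤ t) =>
    MeasurableSpace.comap (fun ω => A.path ω s) inferInstance) s hs) le_rfl

theorem measurable_path (A : DecisionRule E) (t : ℝ≥0) : Measurable fun ω => A.path ω t :=
  (A.adapted t).mono (E.senderInfo_le t) le_rfl

/-- Joint measurability in time and state, from right-continuity of the paths. -/
theorem measurable_uncurry_path (A : DecisionRule E) :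
    Measurable fun p : ℝ × Ω => A.path p.2 p.1.toNNReal := by
  refine measurable_of_tendsto_metrizable
    (f := fun (n : ℕ) (p : ℝ × Ω) => A.path p.2 (min p.1.toNNReal n)) (fun n => ?_) ?_
  · refine measurable_eval_random_time (n : ℝ≥0) (fun s (p : ℝ × Ω) => A.path p.2 s)
      (fun s _ => (A.measurable_path s).comp measurable_snd) (fun p s => (A.path p.2).2 s)
      (fun p => min p.1.toNNReal n) ?_ fun p => min_le_right _ _
    exact (measurable_real_toNNReal.comp measurable_fst).min measurable_const
  · rw [tendsto_pi_nhds]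
    intro p
    refine tendsto_const_nhds.congr' ?_
    obtain ⟨N, hN⟩ := exists_nat_ge p.1.toNNReal
    filter_upwards [eventually_ge_atTop N] with n hn
    rw [min_eq_left (hN.trans (by exact_mod_cast hn))]

/-- The squared error at time `s`. -/
noncomputable def sqError (A : DecisionRule E) (s : ℝ) (ω : Ω) : ℝ≥0∞ :=
  ENNReal.ofReal ((A.path ω s.toNNReal - E.θ s.toNNReal ω) ^ 2)

theorem measurable_uncurry_sqError (A : DecisionRule E) :
    Measurable fun p : ℝ × Ω => A.sqError p.1 p.2 := by
  have hθ : Measurable fun p : ℝ × Ω => E.θ p.1.toNNReal p.2 :=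
    measurable_uncurry_of_continuous_of_measurable (u := fun (s : ℝ) ω => E.θ s.toNNReal ω)
      E.continuous_θ_toNNReal fun s => E.measurable_θ _
  exact ((A.measurable_uncurry_path.sub hθ).pow_const 2).ennreal_ofReal

theorem contLoss_eq (A : DecisionRule E) (t : ℝ≥0) (ω : Ω) :
    A.contLoss t ω = ∫⁻ s in Ioi (t : ℝ),
      ENNReal.ofReal (E.r * Real.exp (-E.r * (s - t))) * A.sqError s ω := by
  have hr := E.r_pos
  refine lintegral_congr fun s => ?_
  rw [sqError, ← ENNReal.ofReal_mul (by positivity)]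

theorem measurable_contLoss (A : DecisionRule E) (t : ℝ≥0) : Measurable (A.contLoss t) := by
  rw [show A.contLoss t = _ from funext (A.contLoss_eq t)]
  have h : Measurable fun p : ℝ × Ω =>
      ENNReal.ofReal (E.r * Real.exp (-E.r * (p.1 - t))) * A.sqError p.1 p.2 :=
    Measurable.mul (by fun_prop) A.measurable_uncurry_sqError
  exact h.lintegral_prod_left'

theorem setLIntegral_contLoss [SFinite P] (A : DecisionRule E) (t : ℝ≥0) (G : Set Ω) :
    ∫⁻ ω in G, A.contLoss t ω ∂P = ∫⁻ s in Ioi (t : ℝ),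
      ENNReal.ofReal (E.r * Real.exp (-E.r * (s - t))) * ∫⁻ ω in G, A.sqError s ω ∂P := by
  simp_rw [A.contLoss_eq]
  have h : Measurable fun p : ℝ × Ω =>
      ENNReal.ofReal (E.r * Real.exp (-E.r * (p.1 - t))) * A.sqError p.1 p.2 :=
    Measurable.mul (by fun_prop) A.measurable_uncurry_sqError
  rw [lintegral_lintegral_swap (f := fun ω s =>
    ENNReal.ofReal (E.r * Real.exp (-E.r * (s - t))) * A.sqError s ω)
    (h.comp measurable_swap).aemeasurable]
  refine lintegral_congr fun s => ?_
  rw [lintegral_const_mul' _ _ ENNReal.ofReal_ne_top]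

theorem measurable_lossBound (t : ℝ≥0) :
    Measurable[𝒢] (E.lossBound 𝒢 t) :=
  (((stronglyMeasurable_condVar.measurable.const_mul _).const_add _).div_const _).ennreal_ofReal

section

variable [IsProbabilityMeasure P]

theorem setLIntegral_lossBound_eq {t : ℝ≥0} (h𝒢 : 𝒢 ≤ E.senderInfo t)
    {G : Set Ω} (hG : MeasurableSet[𝒢] G) :
    ∫⁻ ω in G, E.lossBound 𝒢 t ω ∂P = ∫⁻ s in Ioi (t : ℝ),
      ENNReal.ofReal (E.r * Real.exp (-E.r * (s - t))) *
        ∫⁻ ω in G, ENNReal.ofReal (E.predError 𝒢 t (s - t).toNNReal ω ^ 2) ∂P := by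
  rw [E.setLIntegral_lossBound h𝒢 hG,
    ← setLIntegral_discounted_loss E.r_pos E.two_κ_lt_r (sq_nonneg E.σ) t]
  refine setLIntegral_congr_fun measurableSet_Ioi fun s hs => ?_
  rw [E.setLIntegral_predError_sq h𝒢 _ hG, Real.coe_toNNReal _ (sub_nonneg.2 (le_of_lt hs))]

theorem add_toNNReal_sub {s : ℝ} {t : ℝ≥0} (hs : (t : ℝ) < s) :
    t + (s - t).toNNReal = s.toNNReal := by
  rw [← NNReal.coe_inj, NNReal.coe_add, Real.coe_toNNReal _ (sub_nonneg.2 hs.le),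
    Real.coe_toNNReal _ (t.coe_nonneg.trans hs.le)]
  ring

/-- An agent who learns nothing after time `t` loses at least the bound in the definition of
obedience. -/
theorem setLIntegral_lossBound_le (A : DecisionRule E) {t : ℝ≥0}
    (h𝒢 : 𝒢 ≤ E.senderInfo t) {G : Set Ω} (hG : MeasurableSet[𝒢] G)
    (hA : ∀ s, t ≤ s → Measurable[𝒢] (G.indicator fun ω => A.path ω s)) :
    ∫⁻ ω in G, E.lossBound 𝒢 t ω ∂P ≤ ∫⁻ ω in G, A.contLoss t ω ∂P := by
  rw [setLIntegral_lossBound_eq h𝒢 hG, A.setLIntegral_contLoss]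
  refine setLIntegral_mono' measurableSet_Ioi fun s hs => ?_
  refine mul_le_mul_right ?_ _
  have h := E.setLIntegral_predError_sq_le h𝒢 (s - t).toNNReal hG
    (hA s.toNNReal (NNReal.le_toNNReal_of_coe_le (le_of_lt hs)))
  rwa [add_toNNReal_sub hs] at h

/-- The bound in the definition of obedience is attained by predicting the state from the
information at time `t` alone. -/
theorem setLIntegral_contLoss_eq_lossBound (A : DecisionRule E) {t : ℝ≥0}
    (h𝒢 : 𝒢 ≤ E.senderInfo t) {G : Set Ω} (hG : MeasurableSet[𝒢] G)
    (hA : ∀ s, t ≤ s → ∀ ω ∈ G,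
      A.path ω s = Real.exp (E.κ * ((s : ℝ) - t)) * (P[E.θ t|𝒢]) ω) :
    ∫⁻ ω in G, A.contLoss t ω ∂P = ∫⁻ ω in G, E.lossBound 𝒢 t ω ∂P := by
  rw [setLIntegral_lossBound_eq h𝒢 hG, A.setLIntegral_contLoss]
  refine setLIntegral_congr_fun measurableSet_Ioi fun s hs => ?_
  have hs0 : 0 ≤ s := t.coe_nonneg.trans (le_of_lt hs)
  congr 1
  refine setLIntegral_congr_fun (E.senderInfo_le t _ (h𝒢 _ hG)) fun ω hω => ?_
  rw [sqError, hA _ (NNReal.le_toNNReal_of_coe_le (le_of_lt hs)) ω hω, E.predError_eq,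
    add_toNNReal_sub hs, Real.coe_toNNReal _ hs0, Real.coe_toNNReal _ (sub_nonneg.2 (le_of_lt hs))]
  congr 1
  ring

theorem Obedient.setLIntegral_contLoss_le {A : DecisionRule E} (hA : A.Obedient) {t : ℝ≥0}
    {G : Set Ω} (hG : MeasurableSet[A.info t] G) :
    ∫⁻ ω in G, A.contLoss t ω ∂P ≤ ∫⁻ ω in G, E.lossBound (A.info t) t ω ∂P := by
  have h := (A.info_le_senderInfo t).trans (E.senderInfo_le t)
  rw [← setLIntegral_condLExp h P _ hG]
  exact lintegral_mono_ae (ae_restrict_of_ae (hA t))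

/-- Failure of obedience is detected on an event known to the receiver. -/
theorem exists_setLIntegral_lossBound_lt {A : DecisionRule E} (hA : ¬A.Obedient) :
    ∃ (t : ℝ≥0) (G : Set Ω), MeasurableSet[A.info t] G ∧
      ∫⁻ ω in G, E.lossBound (A.info t) t ω ∂P < ∫⁻ ω in G, A.contLoss t ω ∂P := by
  simp only [Obedient, not_forall] at hA
  obtain ⟨t, ht⟩ := hA
  have h := (A.info_le_senderInfo t).trans (E.senderInfo_le t)
  refine ⟨t, {ω | E.lossBound (A.info t) t ω < condLExp (A.info t) P (A.contLoss t) ω},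
    measurableSet_lt (measurable_lossBound t) (measurable_condLExp _ _ _), ?_⟩
  have hG : MeasurableSet[A.info t]
      {ω | E.lossBound (A.info t) t ω < condLExp (A.info t) P (A.contLoss t) ω} :=
    measurableSet_lt (measurable_lossBound t) (measurable_condLExp _ _ _)
  rw [← setLIntegral_condLExp h P (A.contLoss t) hG]
  refine setLIntegral_strict_mono (h _ hG) (fun h0 => ht ?_) (measurable_condLExp' _ _ _)
    (E.lossBound_integral_ne_top (A.info_le_senderInfo t) hG) (Eventually.of_forall fun _ h => h)
  rw [ae_iff]
  simpa only [not_le, Environment.lossBound] using h0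

end

/-! ### Splitting the loss at a date -/

/-- The loss rate at time `s`, discounted to time zero. -/
noncomputable def discLoss (A : DecisionRule E) (s : ℝ) (ω : Ω) : ℝ≥0∞ :=
  ENNReal.ofReal (E.r * Real.exp (-E.r * s)) * A.sqError s ω

theorem measurable_uncurry_discLoss (A : DecisionRule E) :
    Measurable fun p : ℝ × Ω => A.discLoss p.1 p.2 :=
  Measurable.mul (by fun_prop) A.measurable_uncurry_sqError

theorem measurable_discLoss (A : DecisionRule E) (ω : Ω) : Measurable fun s => A.discLoss s ω :=
  A.measurable_uncurry_discLoss.comp measurable_prodMk_right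

theorem setLIntegral_discLoss (A : DecisionRule E) (t : ℝ≥0) (ω : Ω) :
    ∫⁻ s in Ioi (t : ℝ), A.discLoss s ω = ENNReal.ofReal (Real.exp (-E.r * t)) * A.contLoss t ω := by
  have hr := E.r_pos
  rw [A.contLoss_eq, ← lintegral_const_mul' _ _ ENNReal.ofReal_ne_top]
  refine lintegral_congr fun s => ?_
  rw [discLoss, ← mul_assoc, ← ENNReal.ofReal_mul (by positivity), mul_left_comm, ← Real.exp_add]
  ring_nf

theorem contLoss_zero (A : DecisionRule E) (ω : Ω) :
    A.contLoss 0 ω = ∫⁻ s in Ioi (0 : ℝ), A.discLoss s ω := by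
  simpa using (A.setLIntegral_discLoss 0 ω).symm

theorem contLoss_zero_split (A : DecisionRule E) (t : ℝ≥0) (ω : Ω) :
    A.contLoss 0 ω = (∫⁻ s in Ioc (0 : ℝ) t, A.discLoss s ω) +
      ∫⁻ s in Ioi (t : ℝ), A.discLoss s ω := by
  rw [contLoss_zero, ← Ioc_union_Ioi_eq_Ioi t.coe_nonneg,
    lintegral_union measurableSet_Ioi (Ioc_disjoint_Ioi le_rfl)]

theorem receiverUtility_le_iff {A A' : DecisionRule E} :
    A'.receiverUtility ≤ A.receiverUtility ↔
      ∫⁻ ω, A.contLoss 0 ω ∂P ≤ ∫⁻ ω, A'.contLoss 0 ω ∂P := by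
  rw [receiverUtility, receiverUtility, EReal.neg_le_neg_iff, EReal.coe_ennreal_le_coe_ennreal_iff]

/-- Rules that agree before time `t` have the same losses up to time `t`. -/
theorem setLIntegral_discLoss_congr {A A' : DecisionRule E} {t : ℝ≥0} {ω : Ω}
    (h : ∀ s, s < t → A'.path ω s = A.path ω s) :
    ∫⁻ s in Ioc (0 : ℝ) t, A'.discLoss s ω = ∫⁻ s in Ioc (0 : ℝ) t, A.discLoss s ω := by
  rw [setLIntegral_congr Ioo_ae_eq_Ioc.symm, setLIntegral_congr Ioo_ae_eq_Ioc.symm]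
  refine setLIntegral_congr_fun measurableSet_Ioo fun s hs => ?_
  rw [discLoss, discLoss, sqError, sqError, h _ ((Real.toNNReal_lt_iff_lt_coe hs.1.le).2 hs.2)]

end DecisionRule

/-! ### The deviation that stops learning -/

/-- The path that follows `a` before time `t` and `g` from time `t` on. -/
noncomputable def RC.splice (a : RC) (t : ℝ≥0) (g : ℝ≥0 → ℝ) (hg : Continuous g) : RC :=
  ⟨fun s => if s < t then a s else g s, by
    intro s
    rcases lt_or_ge s t with hs | hs
    · refine (a.2 s).congr_of_eventuallyEq ?_ (if_pos hs)
      filter_upwards [mem_nhdsWithin_of_mem_nhds (Iio_mem_nhds hs)] with x hx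
      exact if_pos hx
    · exact hg.continuousWithinAt.congr (fun x hx => if_neg (hs.trans hx).not_gt)
        (if_neg hs.not_gt)⟩

theorem RC.splice_apply (a : RC) (t : ℝ≥0) (g : ℝ≥0 → ℝ) (hg : Continuous g) (s : ℝ≥0) :
    a.splice t g hg s = if s < t then a s else g s := rfl

namespace DecisionRule

section Forecast

variable {Ω : Type u} [MeasurableSpace Ω] {P : Measure Ω} {E : Environment Ω P}

open scoped Classical in
/-- From time `t` on, on the event `G`, ignore all further information and play the forecast
`e^{κ(s-t)} E[θ_t | 𝓕ᴬ_t]` of the state. -/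
noncomputable def forecastFrom (A : DecisionRule E) (t : ℝ≥0) (G : Set Ω)
    (hG : MeasurableSet[A.info t] G) : DecisionRule E where
  path ω := if ω ∈ G then
      (A.path ω).splice t
        (fun s => Real.exp (E.κ * ((s : ℝ) - t)) * (P[E.θ t|A.info t]) ω) (by fun_prop)
    else A.path ω
  adapted s := by
    rcases lt_or_ge s t with hs | hs
    · refine Eq.mp (congrArg _ (funext fun ω => ?_)) (A.adapted s)
      split_ifs
      · rw [RC.splice_apply, if_pos hs]
      · rfl
    · have hle := (A.info_le_senderInfo t).trans (E.senderInfo_mono hs)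
      have h : Measurable[E.senderInfo s] fun ω => if ω ∈ G then
          Real.exp (E.κ * ((s : ℝ) - t)) * (P[E.θ t|A.info t]) ω else A.path ω s :=
        Measurable.ite (hle _ hG)
          ((stronglyMeasurable_condExp.measurable.mono hle le_rfl).const_mul _) (A.adapted s)
      refine Eq.mp (congrArg _ (funext fun ω => ?_)) h
      split_ifs
      · rw [RC.splice_apply, if_neg hs.not_gt]
      · rfl

variable {A : DecisionRule E} {t : ℝ≥0} {G : Set Ω} {hG : MeasurableSet[A.info t] G}

theorem forecastFrom_path_of_notMem {ω : Ω} (hω : ω ∉ G) :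
    (A.forecastFrom t G hG).path ω = A.path ω :=
  if_neg hω

theorem forecastFrom_path_of_lt {ω : Ω} {s : ℝ≥0} (hs : s < t) :
    (A.forecastFrom t G hG).path ω s = A.path ω s := by
  simp only [forecastFrom]
  split_ifs
  · rw [RC.splice_apply, if_pos hs]
  · rfl

theorem forecastFrom_path_of_mem {ω : Ω} (hω : ω ∈ G) {s : ℝ≥0} (hs : t ≤ s) :
    (A.forecastFrom t G hG).path ω s =
      Real.exp (E.κ * ((s : ℝ) - t)) * (P[E.θ t|A.info t]) ω := by
  simp only [forecastFrom, if_pos hω]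
  rw [RC.splice_apply, if_neg hs.not_gt]

theorem isModification_forecastFrom : A.IsModification (A.forecastFrom t G hG) t G := by
  refine ⟨hG, fun s ω h => ?_, fun s hs => ?_⟩
  · rcases h with h | h
    · exact forecastFrom_path_of_lt h
    · rw [forecastFrom_path_of_notMem h]
  · have h : (G.indicator fun ω => (A.forecastFrom t G hG).path ω s) =
        G.indicator fun ω => Real.exp (E.κ * ((s : ℝ) - t)) * (P[E.θ t|A.info t]) ω := by
      refine indicator_congr fun ω hω => forecastFrom_path_of_mem hω hs
    rw [h]
    exact (stronglyMeasurable_condExp.measurable.const_mul _).indicator hG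

theorem setLIntegral_contLoss_forecastFrom [IsProbabilityMeasure P] :
    ∫⁻ ω in G, (A.forecastFrom t G hG).contLoss t ω ∂P =
      ∫⁻ ω in G, E.lossBound (A.info t) t ω ∂P :=
  setLIntegral_contLoss_eq_lossBound _ (A.info_le_senderInfo t) hG
    fun _ hs _ hω => forecastFrom_path_of_mem hω hs

/-- A rule with finite expected loss that no forecasting deviation improves upon is obedient. -/
theorem obedient_of_forecastFrom_le [IsProbabilityMeasure P] (A : DecisionRule E)
    (hfin : ∫⁻ ω, A.contLoss 0 ω ∂P ≠ ∞)
    (hopt : ∀ t G hG, ∫⁻ ω, A.contLoss 0 ω ∂P ≤ ∫⁻ ω, (A.forecastFrom t G hG).contLoss 0 ω ∂P) :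
    A.Obedient := by
  by_contra hA
  obtain ⟨t, G, hG, hlt⟩ := exists_setLIntegral_lossBound_lt hA
  have hG' : MeasurableSet G := E.senderInfo_le t _ (A.info_le_senderInfo t _ hG)
  set c : ℝ≥0∞ := ENNReal.ofReal (Real.exp (-E.r * t)) with hc
  have hc0 : c ≠ 0 := by
    rw [hc, Ne, ENNReal.ofReal_eq_zero, not_le]
    positivity
  have hsplit : ∀ B : DecisionRule E, ∫⁻ ω, B.contLoss 0 ω ∂P =
      ((∫⁻ ω in Gᶜ, B.contLoss 0 ω ∂P) +
        ∫⁻ ω in G, (∫⁻ s in Ioc (0 : ℝ) t, B.discLoss s ω) ∂P) +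
      c * ∫⁻ ω in G, B.contLoss t ω ∂P := by
    intro B
    rw [← lintegral_add_compl _ hG', add_comm, add_assoc]
    congr 1
    simp_rw [B.contLoss_zero_split t, B.setLIntegral_discLoss]
    rw [lintegral_add_right _ ((B.measurable_contLoss t).const_mul _),
      lintegral_const_mul' _ _ ENNReal.ofReal_ne_top]
  have hpre : ((∫⁻ ω in Gᶜ, (A.forecastFrom t G hG).contLoss 0 ω ∂P) +
        ∫⁻ ω in G, (∫⁻ s in Ioc (0 : ℝ) t, (A.forecastFrom t G hG).discLoss s ω) ∂P) =
      (∫⁻ ω in Gᶜ, A.contLoss 0 ω ∂P) +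
        ∫⁻ ω in G, (∫⁻ s in Ioc (0 : ℝ) t, A.discLoss s ω) ∂P := by
    congr 1
    · refine setLIntegral_congr_fun hG'.compl fun ω hω => ?_
      simp only [contLoss, forecastFrom_path_of_notMem hω]
    · refine lintegral_congr fun ω => setLIntegral_discLoss_congr fun s hs => ?_
      exact forecastFrom_path_of_lt hs
  have h := hopt t G hG
  rw [hsplit A] at hfin
  rw [hsplit A, hsplit (A.forecastFrom t G hG), hpre, setLIntegral_contLoss_forecastFrom] at h
  exact absurd h (not_le.2 (ENNReal.add_lt_add_left (ENNReal.add_ne_top.1 hfin).1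
    (ENNReal.mul_lt_mul_right hc0 ENNReal.ofReal_ne_top hlt)))

theorem lintegral_contLoss_forecastFrom_zero_ne_top [IsProbabilityMeasure P]
    (A : DecisionRule E) :
    ∫⁻ ω, (A.forecastFrom 0 univ .univ).contLoss 0 ω ∂P ≠ ∞ := by
  rw [← setLIntegral_univ, setLIntegral_contLoss_forecastFrom]
  exact E.lossBound_integral_ne_top (A.info_le_senderInfo 0) .univ

end Forecast

end DecisionRule

namespace PolicyClass

variable {Ω : Type u} [MeasurableSpace Ω] {P : Measure Ω} [IsProbabilityMeasure P]
  {E : Environment Ω P}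

theorem IsBestResponse.obedient {𝒜 : PolicyClass.{u, v, w} E} (hC1 : 𝒜.ModificationAxiom)
    {A : DecisionRule E} {S : 𝒜.Label} (h : 𝒜.IsBestResponse A S) : A.Obedient := by
  have hopt : ∀ t G hG, ∫⁻ ω, A.contLoss 0 ω ∂P ≤
      ∫⁻ ω, (A.forecastFrom t G hG).contLoss 0 ω ∂P := fun t G hG =>
    DecisionRule.receiverUtility_le_iff.1
      (h.2 _ (hC1 S A _ t G h.1 DecisionRule.isModification_forecastFrom))
  exact A.obedient_of_forecastFrom_le (ne_top_of_le_ne_top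
    A.lintegral_contLoss_forecastFrom_zero_ne_top (hopt 0 univ .univ)) hopt

end PolicyClass

/-! ### Approximating a random time from above on a grid -/

/-- The index of the first point of the grid `{k / (n + 1)}` strictly after `τ`; the value `0` is
reserved for `τ = ∞`. -/
noncomputable def gridIndex (n : ℕ) (τ : ℝ≥0∞) : ℕ :=
  if τ = ∞ then 0 else ⌊((n : ℝ≥0) + 1) * τ.toNNReal⌋₊ + 1

/-- The grid point with index `k`, where the index `0` stands for `∞`. -/
noncomputable def gridTime (n k : ℕ) : ℝ≥0∞ :=
  if k = 0 then ∞ else (((k : ℝ≥0) / ((n : ℝ≥0) + 1) : ℝ≥0) : ℝ≥0∞)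

theorem measurable_gridIndex (n : ℕ) : Measurable (gridIndex n) :=
  Measurable.ite (measurableSet_singleton ∞) measurable_const
    ((Nat.measurable_floor.comp (ENNReal.measurable_toNNReal.const_mul _)).add_const 1)

theorem measurable_gridTime (n : ℕ) : Measurable (gridTime n) := measurable_from_nat

theorem gridIndex_eq_succ_iff (n k : ℕ) (τ : ℝ≥0∞) :
    gridIndex n τ = k + 1 ↔ τ < (((k + 1 : ℕ) / ((n : ℝ≥0) + 1) : ℝ≥0) : ℝ≥0∞) ∧
      ¬τ < (((k : ℝ≥0) / ((n : ℝ≥0) + 1) : ℝ≥0) : ℝ≥0∞) := by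
  induction τ with
  | top => simp [gridIndex]
  | coe τ =>
    have hn : (0 : ℝ≥0) < (n : ℝ≥0) + 1 := by positivity
    simp only [gridIndex, ENNReal.coe_ne_top, if_false, ENNReal.toNNReal_coe, ENNReal.coe_lt_coe,
      not_lt, Nat.add_right_cancel_iff]
    rw [Nat.floor_eq_iff (zero_le), lt_div_iff₀ hn, div_le_iff₀ hn, mul_comm τ]
    push_cast
    exact and_comm

theorem tendsto_gridTime (τ : ℝ≥0∞) :
    Tendsto (fun n => gridTime n (gridIndex n τ)) atTop (𝓝 τ) := by
  induction τ with
  | top => simp [gridIndex, gridTime]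
  | coe τ =>
    have h : ∀ n, gridTime n (gridIndex n (τ : ℝ≥0∞)) =
        (((⌊((n : ℝ≥0) + 1) * τ⌋₊ + 1 : ℝ≥0) / ((n : ℝ≥0) + 1) : ℝ≥0) : ℝ≥0∞) := fun n => by
      simp [gridIndex, gridTime]
    simp_rw [h]
    rw [ENNReal.tendsto_coe]
    have h0 : Tendsto (fun n : ℕ => τ + 1 / ((n : ℝ≥0) + 1)) atTop (𝓝 τ) := by
      simpa using (tendsto_const_nhds (x := τ)).add tendsto_one_div_add_atTop_nhds_zero_nat
    refine tendsto_of_tendsto_of_tendsto_of_le_of_le tendsto_const_nhds h0 (fun n => ?_) fun n => ?_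
    · change τ ≤ _
      rw [le_div_iff₀ (by positivity), mul_comm]
      exact (Nat.lt_floor_add_one _).le
    · change _ ≤ τ + _
      rw [add_div]
      gcongr
      rw [div_le_iff₀ (by positivity), mul_comm]
      exact Nat.floor_le (zero_le)

theorem le_gridTime (n : ℕ) (τ : ℝ≥0∞) : τ ≤ gridTime n (gridIndex n τ) := by
  by_cases h : τ = ∞
  · simp [h, gridIndex, gridTime]
  · obtain ⟨k, hk⟩ : ∃ k, gridIndex n τ = k + 1 := ⟨_, if_neg h⟩
    rw [hk, gridTime, if_neg k.succ_ne_zero]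
    exact ((gridIndex_eq_succ_iff n k τ).1 hk).1.le

/-! ### Losses before and after a random time -/

theorem measurable_indicator_of_inter {α : Type*} {m : MeasurableSpace α} {G : Set α} {f : α → ℝ}
    (hG : MeasurableSet G) (hf : ∀ B, MeasurableSet B → MeasurableSet (f ⁻¹' B ∩ G)) :
    Measurable (G.indicator f) := by
  intro B hB
  rw [indicator_preimage, Set.ite]
  exact (hf B hB).union ((measurable_zero hB).diff hG)

theorem path_eq_of_lt_disagreementTime {a b : RC} {s : ℝ≥0}
    (h : (s : ℝ≥0∞) < disagreementTime a b) : a s = b s := by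
  by_contra hne
  obtain ⟨t, hst, ht⟩ := ENNReal.lt_iff_exists_nnreal_btwn.1 h
  rw [ENNReal.coe_lt_coe] at hst
  obtain ⟨c, hc, hev⟩ := RC.eventually_lt_sq_sub a b hne
  obtain ⟨y, hy, hyI⟩ := (mem_nhdsGE_iff_exists_Ico_subset' hst).1 hev
  obtain ⟨q, hq1, hq2⟩ := exists_rat_btwn (show (s : ℝ) < min (y : ℝ) t from
    lt_min (by exact_mod_cast hy) (by exact_mod_cast hst))
  have hq0 : (0 : ℝ) ≤ q := s.coe_nonneg.trans hq1.le
  refine ht.not_gt ((disagreementTime_lt_iff a b t).2 ⟨q, ?_, fun he => ?_⟩)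
  · exact (Real.toNNReal_lt_iff_lt_coe hq0).2 (hq2.trans_le (min_le_right _ _))
  · have h1 : c < (a (Real.toNNReal q) - b (Real.toNNReal q)) ^ 2 :=
      hyI ⟨NNReal.le_toNNReal_of_coe_le hq1.le,
        (Real.toNNReal_lt_iff_lt_coe hq0).2 (hq2.trans_le (min_le_left _ _))⟩
    rw [he, sub_self] at h1
    linarith [zero_pow (M₀ := ℝ) two_ne_zero]

theorem disagreementTime_self (a : RC) : disagreementTime a a = ∞ := by
  by_contra h
  obtain ⟨t, ht⟩ := ENNReal.lt_iff_exists_nnreal_btwn.1 (lt_top_iff_ne_top.2 h)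
  obtain ⟨q, -, hq⟩ := (disagreementTime_lt_iff a a t).1 ht.1
  exact hq rfl

namespace DecisionRule

variable {Ω : Type u} [MeasurableSpace Ω] {P : Measure Ω} {E : Environment Ω P}

/-- The discounted loss incurred strictly after time `τ ∈ [0, ∞]`. -/
noncomputable def lossAfter (A : DecisionRule E) (τ : ℝ≥0∞) (ω : Ω) : ℝ≥0∞ :=
  ∫⁻ s in Ioi (0 : ℝ), {s : ℝ | τ < ENNReal.ofReal s}.indicator (fun s => A.discLoss s ω) s

/-- The discounted loss incurred up to time `τ ∈ [0, ∞]`. -/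
noncomputable def lossUpTo (A : DecisionRule E) (τ : ℝ≥0∞) (ω : Ω) : ℝ≥0∞ :=
  ∫⁻ s in Ioi (0 : ℝ), {s : ℝ | τ < ENNReal.ofReal s}ᶜ.indicator (fun s => A.discLoss s ω) s

theorem measurableSet_lt_ofReal (τ : ℝ≥0∞) : MeasurableSet {s : ℝ | τ < ENNReal.ofReal s} :=
  measurableSet_lt measurable_const ENNReal.measurable_ofReal

theorem contLoss_zero_eq_add (A : DecisionRule E) (τ : ℝ≥0∞) (ω : Ω) :
    A.contLoss 0 ω = A.lossUpTo τ ω + A.lossAfter τ ω := by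
  rw [contLoss_zero, lossUpTo, lossAfter,
    ← lintegral_add_right _ ((A.measurable_discLoss ω).indicator (measurableSet_lt_ofReal τ))]
  refine lintegral_congr fun s => ?_
  rw [add_comm, indicator_self_add_compl_apply]

theorem lossAfter_top (A : DecisionRule E) (ω : Ω) : A.lossAfter ∞ ω = 0 := by
  simp [lossAfter]

theorem lossAfter_coe (A : DecisionRule E) (t : ℝ≥0) (ω : Ω) :
    A.lossAfter t ω = ENNReal.ofReal (Real.exp (-E.r * t)) * A.contLoss t ω := by
  have h : {s : ℝ | (t : ℝ≥0∞) < ENNReal.ofReal s} = Ioi (t : ℝ) := by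
    ext s
    rw [mem_Ioi, mem_ofPred_eq, ENNReal.lt_ofReal_iff_toReal_lt ENNReal.coe_ne_top,
      ENNReal.coe_toReal]
  rw [lossAfter, h, lintegral_indicator measurableSet_Ioi,
    Measure.restrict_restrict measurableSet_Ioi,
    inter_eq_self_of_subset_left (Ioi_subset_Ioi t.coe_nonneg), setLIntegral_discLoss]

theorem lossAfter_anti (A : DecisionRule E) {τ τ' : ℝ≥0∞} (h : τ ≤ τ') (ω : Ω) :
    A.lossAfter τ' ω ≤ A.lossAfter τ ω :=
  lintegral_mono fun _ => indicator_le_indicator_of_subset (fun _ hs => h.trans_lt hs)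
    (fun _ => zero_le) _

/-- Lower semicontinuity in the random time, by Fatou's lemma. -/
theorem lossAfter_le_liminf (A : DecisionRule E) {τ : ℝ≥0∞} {τs : ℕ → ℝ≥0∞}
    (h : Tendsto τs atTop (𝓝 τ)) (ω : Ω) :
    A.lossAfter τ ω ≤ liminf (fun n => A.lossAfter (τs n) ω) atTop := by
  refine le_trans ?_ (lintegral_liminf_le fun n =>
    (A.measurable_discLoss ω).indicator (measurableSet_lt_ofReal (τs n)))
  refine lintegral_mono fun s => ?_
  by_cases hs : τ < ENNReal.ofReal s
  · refine le_of_eq (Tendsto.liminf_eq (tendsto_const_nhds.congr' ?_)).symm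
    filter_upwards [h.eventually (gt_mem_nhds hs)] with n hn
    rw [indicator_of_mem (show s ∈ {s : ℝ | τ < ENNReal.ofReal s} from hs),
      indicator_of_mem (show s ∈ {s : ℝ | τs n < ENNReal.ofReal s} from hn)]
  · rw [indicator_of_notMem (show s ∉ {s : ℝ | τ < ENNReal.ofReal s} from hs)]
    exact zero_le

theorem measurable_lossAfter (A : DecisionRule E) {T : Ω → ℝ≥0∞} (hT : Measurable T) :
    Measurable fun ω => A.lossAfter (T ω) ω := by
  have h : Measurable fun p : ℝ × Ω => {p : ℝ × Ω | T p.2 < ENNReal.ofReal p.1}.indicator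
      (fun p => A.discLoss p.1 p.2) p :=
    A.measurable_uncurry_discLoss.indicator
      (measurableSet_lt (hT.comp measurable_snd) (ENNReal.measurable_ofReal.comp measurable_fst))
  exact h.lintegral_prod_left' (μ := volume.restrict (Ioi (0 : ℝ)))

/-- Losses up to the first disagreement coincide; the disagreement date itself is negligible. -/
theorem lossUpTo_disagreementTime (A A' : DecisionRule E) (ω : Ω) :
    A'.lossUpTo (disagreementTime (A.path ω) (A'.path ω)) ω =
      A.lossUpTo (disagreementTime (A.path ω) (A'.path ω)) ω := by
  set τ := disagreementTime (A.path ω) (A'.path ω) with hτ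
  refine lintegral_congr_ae ?_
  have hne : ∀ᵐ s ∂(volume.restrict (Ioi (0 : ℝ))), s ≠ τ.toReal :=
    ae_restrict_of_ae (Measure.ae_ne volume _)
  filter_upwards [ae_restrict_mem measurableSet_Ioi, hne] with s hs0 hs
  by_cases h : τ < ENNReal.ofReal s
  · simp [h]
  · have hlt : ENNReal.ofReal s < τ := by
      refine lt_of_le_of_ne (not_lt.1 h) fun he => hs ?_
      rw [← he, ENNReal.toReal_ofReal (le_of_lt hs0)]
    rw [indicator_of_mem (show s ∈ {s : ℝ | τ < ENNReal.ofReal s}ᶜ from h),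
      indicator_of_mem (show s ∈ {s : ℝ | τ < ENNReal.ofReal s}ᶜ from h), discLoss, discLoss,
      sqError, sqError, path_eq_of_lt_disagreementTime (a := A.path ω) (b := A'.path ω) hlt]

/-! ### Optimality of obedience under the grim trigger -/

section Grim

variable [IsProbabilityMeasure P]

/-- If the first disagreement of `A'` with the obedient rule `A` is an optional time of `A`, and
`A'` has no information beyond that of `A` at that time, then `A'` does no better than `A`. -/
theorem Obedient.lintegral_contLoss_le {A A' : DecisionRule E} (hA : A.Obedient)
    (hT : ∀ s : ℝ≥0, MeasurableSet[A.info s]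
      {ω | disagreementTime (A.path ω) (A'.path ω) < (s : ℝ≥0∞)})
    (hA' : ∀ (s t : ℝ≥0) (B : Set ℝ), s ≤ t → MeasurableSet B → MeasurableSet[A.info s]
      ({ω | A'.path ω t ∈ B} ∩ {ω | disagreementTime (A.path ω) (A'.path ω) < (s : ℝ≥0∞)})) :
    ∫⁻ ω, A.contLoss 0 ω ∂P ≤ ∫⁻ ω, A'.contLoss 0 ω ∂P := by
  set T : Ω → ℝ≥0∞ := fun ω => disagreementTime (A.path ω) (A'.path ω) with hTdef
  have hle : ∀ s, A.info s ≤ ‹MeasurableSpace Ω› := fun s =>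
    (A.info_le_senderInfo s).trans (E.senderInfo_le s)
  have hTm : Measurable T := by
    refine measurable_of_Iio fun c => ?_
    have : T ⁻¹' Iio c = ⋃ q : ℚ, ⋃ _ : ((q : ℝ).toNNReal : ℝ≥0∞) ≤ c,
        {ω | T ω < ((q : ℝ).toNNReal : ℝ≥0∞)} := by
      ext ω
      simp only [mem_preimage, mem_Iio, mem_iUnion, mem_ofPred_eq, exists_prop]
      constructor
      · intro h
        obtain ⟨q, -, hq1, hq2⟩ := ENNReal.lt_iff_exists_rat_btwn.1 h
        exact ⟨q, hq2.le, hq1⟩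
      · rintro ⟨q, hq1, hq2⟩
        exact hq2.trans_le hq1
    rw [this]
    exact MeasurableSet.iUnion fun q => MeasurableSet.iUnion fun _ => hle _ _ (hT _)
  have hKm : ∀ n, Measurable fun ω => gridIndex n (T ω) := fun n => (measurable_gridIndex n).comp hTm
  have hρm : ∀ n, Measurable fun ω => gridTime n (gridIndex n (T ω)) := fun n =>
    (measurable_gridTime n).comp (hKm n)
  have hgrid : ∀ n, ∫⁻ ω, A.lossAfter (gridTime n (gridIndex n (T ω))) ω ∂P ≤
      ∫⁻ ω, A'.lossAfter (gridTime n (gridIndex n (T ω))) ω ∂P := by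
    intro n
    have hsum : ∀ f : Ω → ℝ≥0∞, ∫⁻ ω, f ω ∂P =
        ∑' k : ℕ, ∫⁻ ω in (fun ω => gridIndex n (T ω)) ⁻¹' {k}, f ω ∂P := fun f => by
      rw [← lintegral_iUnion (fun k => hKm n (measurableSet_singleton k))
        (fun i j hij => (disjoint_singleton.2 hij).preimage _), ← preimage_iUnion,
        iUnion_of_singleton, preimage_univ, setLIntegral_univ]
    rw [hsum, hsum]
    refine ENNReal.tsum_le_tsum fun k => ?_
    have hcongr : ∀ B : DecisionRule E, ∫⁻ ω in (fun ω => gridIndex n (T ω)) ⁻¹' {k},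
        B.lossAfter (gridTime n (gridIndex n (T ω))) ω ∂P =
        ∫⁻ ω in (fun ω => gridIndex n (T ω)) ⁻¹' {k}, B.lossAfter (gridTime n k) ω ∂P := fun B =>
      setLIntegral_congr_fun (hKm n (measurableSet_singleton k)) fun ω hω => by
        rw [show gridIndex n (T ω) = k from hω]
    rw [hcongr, hcongr]
    cases k with
    | zero => simp [gridTime, lossAfter_top]
    | succ k =>
      set t : ℝ≥0 := (k + 1 : ℕ) / ((n : ℝ≥0) + 1) with ht
      set t' : ℝ≥0 := (k : ℝ≥0) / ((n : ℝ≥0) + 1) with ht'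
      have htt' : t' ≤ t := by
        rw [ht, ht']
        gcongr
        simp
      have hG : (fun ω => gridIndex n (T ω)) ⁻¹' {k + 1} =
          {ω | T ω < (t : ℝ≥0∞)} \ {ω | T ω < (t' : ℝ≥0∞)} := by
        ext ω
        exact gridIndex_eq_succ_iff n k (T ω)
      have hmono : A.info t' ≤ A.info t := biSup_mono fun _ h => h.trans htt'
      have hGm : MeasurableSet[A.info t] ((fun ω => gridIndex n (T ω)) ⁻¹' {k + 1}) := by
        rw [hG]
        exact (hT t).diff (hmono _ (hT t'))
      rw [show gridTime n (k + 1) = (t : ℝ≥0∞) from if_neg k.succ_ne_zero]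
      simp_rw [lossAfter_coe]
      rw [lintegral_const_mul' _ _ ENNReal.ofReal_ne_top,
        lintegral_const_mul' _ _ ENNReal.ofReal_ne_top]
      refine mul_le_mul_right ((hA.setLIntegral_contLoss_le hGm).trans
        (A'.setLIntegral_lossBound_le (A.info_le_senderInfo t) hGm fun s hs => ?_)) _
      -- On the event that disagreement occurs in the grid cell, `A'` is frozen from `t` on.
      refine measurable_indicator_of_inter hGm fun B hB => ?_
      have : (fun ω => A'.path ω s) ⁻¹' B ∩ (fun ω => gridIndex n (T ω)) ⁻¹' {k + 1} =
          ({ω | A'.path ω s ∈ B} ∩ {ω | T ω < (t : ℝ≥0∞)}) ∩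
            (fun ω => gridIndex n (T ω)) ⁻¹' {k + 1} := by
        rw [hG]
        ext ω
        simp only [mem_inter_iff, mem_preimage, Set.mem_sdiff, mem_ofPred_eq]
        tauto
      rw [this]
      exact (hA' t s B hs hB).inter hGm
  have hafter : ∫⁻ ω, A.lossAfter (T ω) ω ∂P ≤ ∫⁻ ω, A'.lossAfter (T ω) ω ∂P := calc
    ∫⁻ ω, A.lossAfter (T ω) ω ∂P
      ≤ ∫⁻ ω, liminf (fun n => A.lossAfter (gridTime n (gridIndex n (T ω))) ω) atTop ∂P :=
        lintegral_mono fun ω => A.lossAfter_le_liminf (tendsto_gridTime (T ω)) ω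
    _ ≤ liminf (fun n => ∫⁻ ω, A.lossAfter (gridTime n (gridIndex n (T ω))) ω ∂P) atTop :=
        lintegral_liminf_le fun n => A.measurable_lossAfter (hρm n)
    _ ≤ ∫⁻ ω, A'.lossAfter (T ω) ω ∂P := by
        refine liminf_le_of_le (by isBoundedDefault) fun b hb => ?_
        obtain ⟨n, hn⟩ := hb.exists
        exact hn.trans ((hgrid n).trans
          (lintegral_mono fun ω => A'.lossAfter_anti (le_gridTime n (T ω)) ω))
  calc ∫⁻ ω, A.contLoss 0 ω ∂P
      = ∫⁻ ω, (A.lossUpTo (T ω) ω + A.lossAfter (T ω) ω) ∂P :=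
        lintegral_congr fun ω => A.contLoss_zero_eq_add (T ω) ω
    _ = ∫⁻ ω, A.lossUpTo (T ω) ω ∂P + ∫⁻ ω, A.lossAfter (T ω) ω ∂P :=
        lintegral_add_right _ (A.measurable_lossAfter hTm)
    _ ≤ ∫⁻ ω, A.lossUpTo (T ω) ω ∂P + ∫⁻ ω, A'.lossAfter (T ω) ω ∂P := by gcongr
    _ = ∫⁻ ω, (A'.lossUpTo (T ω) ω + A'.lossAfter (T ω) ω) ∂P := by
        rw [lintegral_add_right _ (A'.measurable_lossAfter hTm)]
        congr 1
        exact lintegral_congr fun ω => (A.lossUpTo_disagreementTime A' ω).symm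
    _ = ∫⁻ ω, A'.contLoss 0 ω ∂P :=
        lintegral_congr fun ω => (A'.contLoss_zero_eq_add (T ω) ω).symm

end Grim

end DecisionRule

namespace PolicyClass

variable {Ω : Type u} [MeasurableSpace Ω] {P : Measure Ω} [IsProbabilityMeasure P]
  {E : Environment Ω P}

theorem isBestResponse_grimTrigger {𝒜 : PolicyClass.{u, v, w} E}
    {trig : DecisionRule E → TriggerTime → 𝒜.Label} (hC3 : 𝒜.TriggerCompatibility trig)
    {A : DecisionRule E} (hA : A.Obedient) : 𝒜.IsBestResponse A (trig A grimTrigger) := by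
  refine ⟨(hC3 _ _ _).2 fun B s t hB => ?_, fun A' hA' => ?_⟩
  · -- The rule never disagrees with itself, so only the dates `t < s` matter.
    simp only [grimTrigger, disagreementTime_self, min_eq_right le_top, ENNReal.coe_lt_coe]
    by_cases hts : t < s
    · simp only [hts, ofPred_true, inter_univ]
      exact A.measurable_path_info hts.le hB
    · simp only [hts, ofPred_false, inter_empty]
      exact @MeasurableSet.empty _ (A.info s)
  · rw [DecisionRule.receiverUtility_le_iff]
    have h := (hC3 _ _ _).1 hA'
    have h2 : ∀ (s t : ℝ≥0) (B : Set ℝ), s ≤ t → MeasurableSet B → MeasurableSet[A.info s]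
        ({ω | A'.path ω t ∈ B} ∩
          {ω | disagreementTime (A.path ω) (A'.path ω) < (s : ℝ≥0∞)}) := by
      intro s t B hst hB
      have h1 := h B s t hB
      simp only [min_lt_iff, ENNReal.coe_lt_coe, hst.not_gt, or_false] at h1
      exact h1
    refine hA.lintegral_contLoss_le (fun s => ?_) h2
    simpa using h2 s s univ le_rfl .univ

end PolicyClass

end Persuasion

open Persuasion
theorem proposition1 {Ω : Type u} [MeasurableSpace Ω] (P : Measure Ω) [IsProbabilityMeasure P]
    (E : Environment Ω P) (𝒜 : PolicyClass.{u, v, w} E)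
    (trig : DecisionRule E → TriggerTime → 𝒜.Label)
    (hC1 : 𝒜.ModificationAxiom)
    (hC2 : 𝒜.TriggerAdmissible trig)
    (hC3 : 𝒜.TriggerCompatibility trig)
    (A : DecisionRule E) :
    ((∃ S : 𝒜.Label, 𝒜.IsBestResponse A S) ↔ A.Obedient) ∧
      (A.Obedient → 𝒜.IsBestResponse A (trig A grimTrigger)) :=
  ⟨⟨fun ⟨_, hS⟩ => hS.obedient hC1, fun hA => ⟨_, PolicyClass.isBestResponse_grimTrigger hC3 hA⟩⟩,
    PolicyClass.isBestResponse_grimTrigger hC3⟩
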